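/- Let $n \ge 1$, let $I_n$ be the $n\times n$ identity matrix and $J = \begin{pmatrix} 0 & I_n \\ -I_n & 0\end{pmatrix}$. The Heisenberg group $\mathbb{H}^n$ is $\mathbb{R}^{2n}\times\mathbb{R}$ with the group law $(x,t)\cdot(y,s) = (x+y,\ t+s+x^{t}Jy)$, so that $(x,t)^{-1} = (-x,-t)$, with Lebesgue measure as its Haar measure; $L^p(\mathbb{H}^n) = L^p(\mathbb{R}^{2n+1})$ (complex-valued functions). Let $A$ be a real symmetric $2n\times 2n$ matrix with $\det(2A+J)\neq 0$ and $\det(2A-J)\ne 0$, and let $\mu_A$ be the Borel measure on $\mathbb{H}^n$ given by $\mu_A(E) = \int_{\mathbb{R}^{2n}} \chi_E(y, y^{t}Ay)\,dy$. Then the operator $T_{\mu_A}$ of convolution by $\mu_A$ on the right, $$T_{\mu_A}f(x,t) = (f * \mu_A)(x,t) = \int_{\mathbb{H}^n} f\big((x,t)\cdot(y,s)^{-1}\big)\,d\mu_A(y,s),$$ is bounded from $L^{\frac{2n+2}{2n+1}}(\mathbb{H}^n)$ to $L^{2n+2}(\mathbb{H}^n)$: there is a constant $C<\infty$, depending only on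 $n$ and $A$, such that for every $f\in L^{\frac{2n+2}{2n+1}}(\mathbb{H}^n)$ the integral converges absolutely for almost every $(x,t)$, the function $T_{\mu_A}f$ belongs to $L^{2n+2}(\mathbb{H}^n)$, and $$\|T_{\mu_A}f\|_{L^{2n+2}(\mathbb{H}^n)} \le C\,\|f\|_{L^{\frac{2n+2}{2n+1}}(\mathbb{H}^n)}.$$ -/

import Mathlib

open MeasureTheory
open scoped Matrix NNReal ENNReal

noncomputable section

namespace Heis

/-- The skew-symmetric `2n × 2n` matrix with blocks `0, I, -I, 0`.
(Mathlib's `Matrix.J` has the opposite sign.) -/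
def symplecticJ (n : ℕ) : Matrix (Fin n ⊕ Fin n) (Fin n ⊕ Fin n) ℝ :=
  Matrix.fromBlocks 0 1 (-1) 0

/-- The standard symplectic form `⟨x, y⟩ = xᵗ J y` on `ℝ²ⁿ`. -/
def symp {n : ℕ} (x y : Fin n ⊕ Fin n → ℝ) : ℝ := x ⬝ᵥ (symplecticJ n *ᵥ y)

/-- The underlying space `ℝ²ⁿ × ℝ` of the Heisenberg group. -/
def HeisenbergGroup (n : ℕ) : Type := (Fin n ⊕ Fin n → ℝ) × ℝ

variable {n : ℕ}

theorem symp_self (x : Fin n ⊕ Fin n → ℝ) : symp x x = 0 := by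
  simp [symp, symplecticJ, Matrix.mulVec, dotProduct, Fintype.sum_sum_type, Matrix.one_apply,
    mul_comm]

namespace HeisenbergGroup

instance : TopologicalSpace (HeisenbergGroup n) :=
  inferInstanceAs (TopologicalSpace ((Fin n ⊕ Fin n → ℝ) × ℝ))

/-- Lebesgue measure on `ℝ²ⁿ × ℝ`, which is the Haar measure of the group. -/
instance : MeasureSpace (HeisenbergGroup n) :=
  inferInstanceAs (MeasureSpace ((Fin n ⊕ Fin n → ℝ) × ℝ))

instance : BorelSpace (HeisenbergGroup n) :=
  inferInstanceAs (BorelSpace ((Fin n ⊕ Fin n → ℝ) × ℝ))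

/-- `(x, t) · (y, s) = (x + y, t + s + ⟨x, y⟩)`. -/
instance : Mul (HeisenbergGroup n) :=
  ⟨fun p q => (p.1 + q.1, p.2 + q.2 + symp p.1 q.1)⟩

instance : One (HeisenbergGroup n) := ⟨((0 : Fin n ⊕ Fin n → ℝ), (0 : ℝ))⟩

/-- `(x, t)⁻¹ = (-x, -t)`. -/
instance : Inv (HeisenbergGroup n) := ⟨fun p => (-p.1, -p.2)⟩

instance : Group (HeisenbergGroup n) where
  mul_assoc a b c := by
    refine Prod.ext (add_assoc a.1 b.1 c.1) ?_
    change (a.2 + b.2 + symp a.1 b.1) + c.2 + symp (a.1 + b.1) c.1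
      = a.2 + (b.2 + c.2 + symp b.1 c.1) + symp a.1 (b.1 + c.1)
    simp only [symp, add_dotProduct, Matrix.mulVec_add, dotProduct_add]
    ring
  one_mul a := by
    refine Prod.ext (zero_add a.1) ?_
    change 0 + a.2 + symp 0 a.1 = a.2
    simp [symp]
  mul_one a := by
    refine Prod.ext (add_zero a.1) ?_
    change a.2 + 0 + symp a.1 0 = a.2
    simp [symp]
  inv_mul_cancel a := by
    refine Prod.ext (neg_add_cancel a.1) ?_
    change -a.2 + a.2 + symp (-a.1) a.1 = 0
    have h := symp_self a.1
    simp only [symp] at h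
    simp [symp, h]

end HeisenbergGroup

/-- The quadratic form `φ(y) = yᵗ A y`. -/
def quadForm (A : Matrix (Fin n ⊕ Fin n) (Fin n ⊕ Fin n) ℝ) (y : Fin n ⊕ Fin n → ℝ) : ℝ :=
  y ⬝ᵥ (A *ᵥ y)

/-- The parametrization `y ↦ (y, φ(y))` of the graph of `φ`. -/
def graphMap (A : Matrix (Fin n ⊕ Fin n) (Fin n ⊕ Fin n) ℝ) (y : Fin n ⊕ Fin n → ℝ) :
    HeisenbergGroup n := (y, quadForm A y)

theorem measurable_graphMap (A : Matrix (Fin n ⊕ Fin n) (Fin n ⊕ Fin n) ℝ) :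
    Measurable (graphMap A) := by
  have h : Continuous (fun y : Fin n ⊕ Fin n → ℝ => y ⬝ᵥ (A *ᵥ y)) := by
    fun_prop
  exact Measurable.prodMk measurable_id h.measurable

/-- The Borel measure `μ_A(E) = ∫ χ_E(y, φ(y)) dy`, as the image of Lebesgue measure on `ℝ²ⁿ`
under `y ↦ (y, φ(y))`. -/
def graphMeasure (A : Matrix (Fin n ⊕ Fin n) (Fin n ⊕ Fin n) ℝ) :
    Measure (HeisenbergGroup n) :=
  Measure.map (graphMap A) volume

theorem graphMeasure_apply (A : Matrix (Fin n ⊕ Fin n) (Fin n ⊕ Fin n) ℝ)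
    {E : Set (HeisenbergGroup n)} (hE : MeasurableSet E) :
    graphMeasure A E = ∫⁻ y, E.indicator (fun _ => (1 : ℝ≥0∞)) (graphMap A y) := by
  rw [graphMeasure, ← lintegral_map (measurable_const.indicator hE) (measurable_graphMap A),
    lintegral_indicator hE]
  simp

/-- Convolution by `μ` on the right: `(f ∗ μ)(x,t) = ∫ f((x,t) · (y,s)⁻¹) dμ(y,s)`. -/
def rightConv (f : HeisenbergGroup n → ℂ) (μ : Measure (HeisenbergGroup n)) :
    HeisenbergGroup n → ℂ :=
  fun p => ∫ q, f (p * q⁻¹) ∂μ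

end Heis

end

noncomputable section

set_option linter.unusedSectionVars false

namespace Heis
open scoped FourierTransform ComplexConjugate

/-! ### Plancherel for functions that are both integrable and square integrable. -/

section FourierL2

variable {V : Type*} [NormedAddCommGroup V] [InnerProductSpace ℝ V] [FiniteDimensional ℝ V]
  [MeasurableSpace V] [BorelSpace V]

/-! Put `φ = quadForm A` and `B = (2A + J)ᵗ`. Replacing `y` by `x - y` in the convolution integral,
and using the symmetry of `A` and `xᵗJx = 0`, turns the phase into `t - φ(x) + Bx·y - φ(y)`. So, up
to two measure-preserving shears and the invertible change of variable `x ↦ Bx`, the operator is the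
Radon-type transform `R G(x,t) = ∫ G(y, t + ⟨x,y⟩) dy` on `ℝᵈ × ℝ`, `d = 2n`, and it suffices to map
`L^p` to `L^q` for the conjugate exponents `p = (2n+2)/(2n+1)`, `q = 2n+2`.

By duality this is a bound for the pairing of `R g` with `w` by `‖g‖_p ‖w‖_p`. A Fourier transform
in `t` (dual variable `l`) turns `R g` into the Fourier transform in `y` of `ĝ(·, l)`, evaluated at
`-l x`. Hölder and Hausdorff-Young in `x` bound the slice at `l` by `|l|^(-d/q) ‖ĝ(·,l)‖_p
‖ŵ(·,l)‖_p`. The weight is shared equally between `g` and `w`, and Cauchy-Schwarz in `l` leaves a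
weighted `L²(dl)` norm of `‖ĝ(·,l)‖_p`. Minkowski (as `p < 2`) and the one-dimensional Pitt
inequality bound it by `‖g‖_p`. Pitt requires the weight `|l|^(-σ)` with `σ = 2/p - 1`, and for
these exponents this is exactly `d/q`.

The main lemmas are `hausdorff_young`, `pitt_inequality`, `lintegral_rpow_lintegral_le`,
`BoundedSupported.lintegral_pairing_le`, `radon_bound` and `lintegral_graph_eq_radonPi`. -/

theorem continuous_fourier {f : V → ℂ} (hf : Integrable f) : Continuous (𝓕 f) :=
  VectorFourier.fourierIntegral_continuous Real.continuous_fourierChar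
    (by exact continuous_inner) hf

theorem norm_fourier_le (f : V → ℂ) (w : V) : ‖𝓕 f w‖ ≤ ∫ v, ‖f v‖ :=
  VectorFourier.norm_fourierIntegral_le_integral_norm _ _ _ _ _

/-- The `L²` Fourier transform of an integrable function is given by the Fourier integral. -/
theorem fourier_toLp_ae_eq {f : V → ℂ} (hf : Integrable f) (hf2 : MemLp f 2) :
    (𝓕 (hf2.toLp f) : Lp ℂ 2 (volume : Measure V)) =ᵐ[volume] 𝓕 f := by
  -- Both sides are locally integrable, so testing against smooth compactly supported `g` suffices.
  -- The `L²` transform agrees with the distributional one, which moves `𝓕` onto `g`; the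
  -- multiplication formula for integrable functions moves it back to `f`.
  refine ae_eq_of_integral_contDiff_smul_eq
    ((Lp.memLp _).locallyIntegrable (by norm_num))
    (continuous_fourier hf).locallyIntegrable ?_
  intro g hg hgc
  have hgc' : HasCompactSupport (fun x => (g x : ℂ)) := hgc.comp_left Complex.ofReal_zero
  have hg' : ContDiff ℝ ((⊤ : ℕ∞) : WithTop ℕ∞) (fun x => (g x : ℂ)) :=
    Complex.ofRealCLM.contDiff.comp hg
  set G : SchwartzMap V ℂ := hgc'.toSchwartzMap hg' with hG
  have hGx : ∀ x, G x = (g x : ℂ) := fun x => rfl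
  have h1 := congrArg (fun T => T G) (Lp.fourier_toTemperedDistribution_eq (hf2.toLp f))
  simp only [TemperedDistribution.fourier_apply, Lp.toTemperedDistribution_apply] at h1
  have h2 : ∫ x, (𝓕 G : SchwartzMap V ℂ) x • (hf2.toLp f) x = ∫ x, 𝓕 (G : V → ℂ) x • f x := by
    refine integral_congr_ae ?_
    filter_upwards [hf2.coeFn_toLp] with x hx
    rw [hx, SchwartzMap.fourier_coe]
  have h3 : ∫ x, 𝓕 (G : V → ℂ) x • f x = ∫ x, G x • 𝓕 f x := by
    have := VectorFourier.integral_fourierIntegral_smul_eq_flip (μ := (volume : Measure V))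
      (ν := (volume : Measure V)) (L := innerₗ V) (f := (G : V → ℂ)) (g := f)
      Real.continuous_fourierChar (by exact continuous_inner) G.integrable hf
    rw [flip_innerₗ] at this
    exact this
  rw [h2, h3] at h1
  simp only [hGx, Complex.coe_smul] at h1
  exact h1.symm

theorem integral_conj_fourier_mul_fourier {f g : V → ℂ} (hf : Integrable f) (hf2 : MemLp f 2)
    (hg : Integrable g) (hg2 : MemLp g 2) :
    ∫ w, conj (𝓕 f w) * 𝓕 g w = ∫ v, conj (f v) * g v := by
  have h := Lp.inner_fourier_eq (hf2.toLp f) (hg2.toLp g)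
  rw [L2.inner_def, L2.inner_def] at h
  calc _ = ∫ w, inner ℂ ((𝓕 (hf2.toLp f) : Lp ℂ 2 (volume : Measure V)) w)
        ((𝓕 (hg2.toLp g) : Lp ℂ 2 (volume : Measure V)) w) := by
        refine integral_congr_ae ?_
        filter_upwards [fourier_toLp_ae_eq hf hf2, fourier_toLp_ae_eq hg hg2] with w h1 h2
        rw [h1, h2, RCLike.inner_apply, mul_comm]
    _ = _ := h
    _ = _ := by
        refine integral_congr_ae ?_
        filter_upwards [hf2.coeFn_toLp, hg2.coeFn_toLp] with w h1 h2
        rw [h1, h2, RCLike.inner_apply, mul_comm]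

theorem eLpNorm_two_fourier {f : V → ℂ} (hf : Integrable f) (hf2 : MemLp f 2) :
    eLpNorm (𝓕 f) 2 = eLpNorm f 2 := by
  rw [← eLpNorm_congr_ae (fourier_toLp_ae_eq hf hf2), ← eLpNorm_congr_ae hf2.coeFn_toLp,
    ← Lp.enorm_def, ← Lp.enorm_def, ← ofReal_norm, ← ofReal_norm, Lp.norm_fourier_eq]

theorem lintegral_enorm_sq_fourier {f : V → ℂ} (hf : Integrable f) (hf2 : MemLp f 2) :
    ∫⁻ w, ‖𝓕 f w‖ₑ ^ (2 : ℝ) = ∫⁻ v, ‖f v‖ₑ ^ (2 : ℝ) := by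
  have h := eLpNorm_two_fourier hf hf2
  have h2 : (2 : ℝ≥0∞) = ((2 : ℝ≥0) : ℝ≥0∞) := rfl
  have e := fun u : V → ℂ => eLpNorm_nnreal_pow_eq_lintegral (f := u) (p := 2)
    (μ := (volume : Measure V)) two_ne_zero
  simp only [NNReal.coe_ofNat] at e
  rw [← e, ← e, ← h2, h]

theorem enorm_fourier_le (f : V → ℂ) (w : V) : ‖𝓕 f w‖ₑ ≤ ∫⁻ v, ‖f v‖ₑ := by
  rw [Real.fourier_eq]
  refine (enorm_integral_le_lintegral_enorm _).trans_eq ?_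
  have h1 (z : Circle) : ‖(z : ℂ)‖ₑ = 1 := by rw [← ofReal_norm, Circle.norm_coe]; simp
  simp [Circle.smul_def, enorm_mul, h1]

end FourierL2

/-! ### Power integrals and the Hausdorff-Young inequality by real interpolation. -/

theorem setLIntegral_Ioc_rpow {c s : ℝ} (hc : 0 ≤ c) (hs : -1 < s) :
    ∫⁻ a in Set.Ioc 0 c, ENNReal.ofReal (a ^ s) = ENNReal.ofReal (c ^ (s + 1) / (s + 1)) := by
  have hi : IntegrableOn (fun a : ℝ => a ^ s) (Set.Ioc 0 c) :=
    (intervalIntegrable_iff_integrableOn_Ioc_of_le hc).1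
      (intervalIntegral.intervalIntegrable_rpow' hs)
  rw [← ofReal_integral_eq_lintegral_ofReal hi, ← intervalIntegral.integral_of_le hc,
    integral_rpow (Or.inl hs), Real.zero_rpow (by linarith), sub_zero]
  filter_upwards [ae_restrict_mem measurableSet_Ioc] with a ha
  exact Real.rpow_nonneg ha.1.le _

theorem setLIntegral_Ioi_rpow {c s : ℝ} (hc : 0 < c) (hs : s < -1) :
    ∫⁻ a in Set.Ioi c, ENNReal.ofReal (a ^ s) = ENNReal.ofReal (-c ^ (s + 1) / (s + 1)) := by
  rw [← ofReal_integral_eq_lintegral_ofReal (integrableOn_Ioi_rpow_of_lt hs hc),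
    integral_Ioi_rpow_of_lt hs hc]
  filter_upwards [ae_restrict_mem measurableSet_Ioi] with a ha
  exact Real.rpow_nonneg (hc.trans ha).le _

theorem ofReal_norm_rpow {s : ℝ} (hs : 0 ≤ s) (z : ℂ) :
    ENNReal.ofReal (‖z‖ ^ s) = ‖z‖ₑ ^ s := by
  rw [← ENNReal.ofReal_rpow_of_nonneg (norm_nonneg _) hs, ofReal_norm]

section HausdorffYoung

variable {V : Type*} [NormedAddCommGroup V] [InnerProductSpace ℝ V] [FiniteDimensional ℝ V]
  [MeasurableSpace V] [BorelSpace V]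

theorem fourier_indicator_add_compl {f : V → ℂ} (hf : Integrable f) {S : Set V}
    (hS : MeasurableSet S) (w : V) :
    𝓕 f w = 𝓕 (S.indicator f) w + 𝓕 (Sᶜ.indicator f) w := by
  have h := VectorFourier.fourierIntegral_add (μ := (volume : Measure V)) (L := innerₗ V)
    Real.continuous_fourierChar (by exact continuous_inner) (hf.indicator hS)
    (hf.indicator hS.compl)
  rw [Set.indicator_self_add_compl] at h
  exact congrFun h w

theorem lintegral_enorm_sq_fourier_indicator {f : V → ℂ} (hf : Integrable f) (hf2 : MemLp f 2)
    {S : Set V} (hS : MeasurableSet S) :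
    ∫⁻ w, ‖𝓕 (S.indicator f) w‖ₑ ^ (2 : ℝ) = ∫⁻ v in S, ‖f v‖ₑ ^ (2 : ℝ) := by
  rw [lintegral_enorm_sq_fourier (hf.indicator hS) (hf2.indicator hS), ← lintegral_indicator hS]
  refine lintegral_congr fun v => ?_
  by_cases hv : v ∈ S <;> simp [hv]

theorem enorm_fourier_indicator_le (f : V → ℂ) {S : Set V} (hS : MeasurableSet S) (w : V) :
    ‖𝓕 (S.indicator f) w‖ₑ ≤ ∫⁻ v in S, ‖f v‖ₑ := by
  refine (enorm_fourier_le _ w).trans_eq ?_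
  rw [← lintegral_indicator hS]
  refine lintegral_congr fun v => ?_
  by_cases hv : v ∈ S <;> simp [hv]

/-- The function is cut at a height depending on `α`, chosen so that the large part has `L¹` norm at
most `α`. Its transform is then at most `α`, so where `‖𝓕 f‖ > 2α` the transform of the small part
exceeds `α`; Chebyshev and Plancherel finish. -/
theorem volume_lt_norm_fourier_le {p k α : ℝ} (hk : 0 < k) (hα : 0 < α) (hp : 1 < p)
    {f : V → ℂ} (hm : Measurable f) (hf : Integrable f) (hf2 : MemLp f 2)
    (hK : ∫⁻ v, ‖f v‖ₑ ^ p = ENNReal.ofReal k) :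
    volume {w | α < ‖𝓕 f w‖ / 2} ≤
      (∫⁻ v in {v | α * ‖f v‖ ^ (p - 1) ≤ k}, ‖f v‖ₑ ^ (2 : ℝ)) / ENNReal.ofReal (α ^ 2) := by
  set S : Set V := {v | α * ‖f v‖ ^ (p - 1) ≤ k} with hSdef
  have hS : MeasurableSet S :=
    measurableSet_le ((hm.norm.pow_const _).const_mul _) measurable_const
  -- Off `S` one has `‖f‖ ≤ (α / k) ‖f‖ ^ p`, and the integral of the right side is at most `α`.
  have hbig : ∫⁻ v in Sᶜ, ‖f v‖ₑ ≤ ENNReal.ofReal α := by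
    calc ∫⁻ v in Sᶜ, ‖f v‖ₑ ≤ ∫⁻ v in Sᶜ, ENNReal.ofReal (α / k) * ‖f v‖ₑ ^ p := by
          refine setLIntegral_mono' hS.compl fun v hv => ?_
          have hv' : k < α * ‖f v‖ ^ (p - 1) := not_le.1 hv
          rw [← ofReal_norm_rpow (by linarith), ← ENNReal.ofReal_mul (by positivity),
            ← ofReal_norm]
          refine ENNReal.ofReal_le_ofReal ?_
          have h0 : 0 < ‖f v‖ := by
            rcases (norm_nonneg (f v)).eq_or_lt with h | h
            · rw [← h, Real.zero_rpow (by linarith)] at hv'; linarith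
            · exact h
          have : ‖f v‖ ^ p = ‖f v‖ ^ (p - 1) * ‖f v‖ := by
            rw [← Real.rpow_add_one h0.ne']; ring_nf
          rw [this, div_mul_eq_mul_div, le_div_iff₀ hk]
          nlinarith
      _ ≤ ∫⁻ v, ENNReal.ofReal (α / k) * ‖f v‖ₑ ^ p := setLIntegral_le_lintegral _ _
      _ = ENNReal.ofReal α := by
          rw [lintegral_const_mul _ (hm.enorm.pow_const _), hK, ← ENNReal.ofReal_mul (by positivity),
            div_mul_cancel₀ _ hk.ne']
  have hα2 : ENNReal.ofReal (α ^ 2) = ENNReal.ofReal α ^ (2 : ℝ) := by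
    rw [ENNReal.ofReal_rpow_of_pos hα]; norm_num
  rw [← lintegral_enorm_sq_fourier_indicator hf hf2 hS, hα2]
  refine le_trans (measure_mono ?_) (meas_ge_le_lintegral_div (ε := ENNReal.ofReal α ^ (2 : ℝ))
    ((continuous_fourier (hf.indicator hS)).measurable.enorm.pow_const _).aemeasurable ?_ ?_)
  · intro w hw
    have hw' : α < ‖𝓕 f w‖ / 2 := hw
    refine ENNReal.rpow_le_rpow ?_ zero_le_two
    have h1 : ‖𝓕 (Sᶜ.indicator f) w‖ ≤ α := by
      have := (enorm_fourier_indicator_le f hS.compl w).trans hbig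
      rwa [← ofReal_norm, ENNReal.ofReal_le_ofReal_iff hα.le] at this
    have h2 := norm_add_le (𝓕 (S.indicator f) w) (𝓕 (Sᶜ.indicator f) w)
    rw [← fourier_indicator_add_compl hf hS] at h2
    rw [← ofReal_norm]
    exact ENNReal.ofReal_le_ofReal (by linarith)
  · simp [hα]
  · simp

/-- Here `a` stands for `‖f v‖`. The power is integrated up to `α = k / a ^ (p - 1)`, and `(p - 1)(q
- 2) = 2 - p` turns the factor `a ^ 2` into `a ^ p`. Convergence at `0` is where `q > 2` enters. -/
theorem setLIntegral_split_le {a k p q : ℝ} (ha : 0 < a) (hk : 0 < k)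
    (hpq : p.HolderConjugate q) (hq : 2 < q) :
    ∫⁻ α in Set.Ioi (0 : ℝ), {α : ℝ | α * a ^ (p - 1) ≤ k}.indicator
      (fun α => ENNReal.ofReal (α ^ (q - 3)) * ENNReal.ofReal (a ^ (2 : ℝ))) α
      = ENNReal.ofReal (k ^ (q - 2) / (q - 2)) * ENNReal.ofReal (a ^ p) := by
  have hap : 0 < a ^ (p - 1) := Real.rpow_pos_of_pos ha _
  have hset : {α : ℝ | α * a ^ (p - 1) ≤ k} = Set.Iic (k / a ^ (p - 1)) := by
    ext α; simp [le_div_iff₀ hap]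
  have hc : 0 ≤ k / a ^ (p - 1) := by positivity
  rw [hset, lintegral_indicator measurableSet_Iic, Measure.restrict_restrict measurableSet_Iic,
    Set.Iic_inter_Ioi, lintegral_mul_const _ (by fun_prop), setLIntegral_Ioc_rpow hc (by linarith),
    ← ENNReal.ofReal_mul, ← ENNReal.ofReal_mul]
  · congr 1
    have h1 : q - 3 + 1 = q - 2 := by ring
    have h2 : p * q = p + q := by
      have := hpq.inv_add_inv_eq_one
      have hp0 := hpq.pos.ne'
      have hq0 := hpq.symm.pos.ne'
      field_simp at this
      linarith
    have h3 : a ^ (2 : ℝ) / (a ^ (p - 1)) ^ (q - 2) = a ^ p := by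
      rw [← Real.rpow_mul ha.le, ← Real.rpow_sub ha]
      congr 1
      linear_combination -h2
    rw [h1, Real.div_rpow hk.le hap.le, ← h3]
    ring
  · have : 0 < q - 2 := by linarith
    positivity
  · have : 0 < q - 3 + 1 := by linarith
    positivity

theorem hausdorff_young {p q : ℝ} (hpq : p.HolderConjugate q) (hq : 2 < q) :
    ∃ C : ℝ≥0, ∀ f : V → ℂ, Measurable f → Integrable f → MemLp f 2 →
      ∫⁻ w, ‖𝓕 f w‖ₑ ^ q ≤ C * (∫⁻ v, ‖f v‖ₑ ^ p) ^ (q - 1) := by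
  have hp := hpq.lt
  -- `2 ^ q` comes from halving `‖𝓕 f‖`, `q` from the layer-cake formula, and `1 / (q - 2)` from the
  -- power integral in `α`.
  refine ⟨Real.toNNReal (2 ^ q * (q / (q - 2))), fun f hm hf hf2 => ?_⟩
  have hq2 : 0 < q - 2 := by linarith
  have hC : (0 : ℝ) < 2 ^ q * (q / (q - 2)) := by positivity
  rcases eq_or_ne (∫⁻ v, ‖f v‖ₑ ^ p) 0 with h0 | h0
  · have h0' : f =ᵐ[volume] 0 := by
      rw [lintegral_eq_zero_iff (hm.enorm.pow_const _)] at h0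
      filter_upwards [h0] with v hv
      simpa [hpq.pos] using hv
    have hz : ∀ w, 𝓕 f w = 0 := fun w => by
      rw [Real.fourier_eq]
      refine integral_eq_zero_of_ae ?_
      filter_upwards [h0'] with v hv
      simp [hv]
    simp [hz, hpq.symm.pos]
  rcases eq_or_ne (∫⁻ v, ‖f v‖ₑ ^ p) ∞ with hi | hi
  · rw [hi, ENNReal.top_rpow_of_pos (by linarith), ENNReal.mul_top]
    · exact le_top
    · simpa using hC
  obtain ⟨k, hk, hK⟩ : ∃ k : ℝ, 0 < k ∧ ∫⁻ v, ‖f v‖ₑ ^ p = ENNReal.ofReal k :=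
    ⟨_, ENNReal.toReal_pos h0 hi, (ENNReal.ofReal_toReal hi).symm⟩
  have hcont := continuous_fourier hf
  have step1 : ∫⁻ w, ‖𝓕 f w‖ₑ ^ q = ENNReal.ofReal (2 ^ q) *
      (ENNReal.ofReal q * ∫⁻ α in Set.Ioi (0 : ℝ), volume {w | α < ‖𝓕 f w‖ / 2} *
        ENNReal.ofReal (α ^ (q - 1))) := by
    rw [← lintegral_rpow_eq_lintegral_meas_lt_mul volume
      (Filter.Eventually.of_forall fun w => by positivity) (by fun_prop) (by linarith),
      ← lintegral_const_mul _ (by fun_prop)]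
    refine lintegral_congr fun w => ?_
    rw [← ENNReal.ofReal_mul (by positivity), ← Real.mul_rpow (by norm_num) (by positivity),
      mul_div_cancel₀ _ two_ne_zero, ofReal_norm_rpow (by linarith)]
  have step2 : ∫⁻ α in Set.Ioi (0 : ℝ), volume {w | α < ‖𝓕 f w‖ / 2} * ENNReal.ofReal (α ^ (q - 1))
      ≤ ∫⁻ α in Set.Ioi (0 : ℝ), ∫⁻ v, {α : ℝ | α * ‖f v‖ ^ (p - 1) ≤ k}.indicator
      (fun α => ENNReal.ofReal (α ^ (q - 3)) * ENNReal.ofReal (‖f v‖ ^ (2 : ℝ))) α := by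
    refine setLIntegral_mono' measurableSet_Ioi fun α hα => ?_
    have hα : 0 < α := hα
    have hS : MeasurableSet {v | α * ‖f v‖ ^ (p - 1) ≤ k} :=
      measurableSet_le ((hm.norm.pow_const _).const_mul _) measurable_const
    refine (mul_le_mul_left (volume_lt_norm_fourier_le hk hα hp hm hf hf2 hK) _).trans_eq ?_
    rw [div_eq_mul_inv, mul_assoc, mul_comm, ← ENNReal.ofReal_inv_of_pos (by positivity),
      ← ENNReal.ofReal_mul (by positivity), ← lintegral_indicator hS,
      ← lintegral_const_mul _ ((hm.enorm.pow_const _).indicator hS)]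
    refine lintegral_congr fun v => ?_
    have e : (α ^ 2)⁻¹ * α ^ (q - 1) = α ^ (q - 3) := by
      rw [← Real.rpow_natCast, ← Real.rpow_neg hα.le, ← Real.rpow_add hα]
      congr 1; push_cast; ring
    by_cases hv : α * ‖f v‖ ^ (p - 1) ≤ k
    · rw [Set.indicator_of_mem (by exact hv), Set.indicator_of_mem (by exact hv), e,
        ofReal_norm_rpow zero_le_two]
    · rw [Set.indicator_of_notMem (by exact hv), Set.indicator_of_notMem (by exact hv), mul_zero]
  have step3 : ∫⁻ α in Set.Ioi (0 : ℝ), ∫⁻ v, {α : ℝ | α * ‖f v‖ ^ (p - 1) ≤ k}.indicator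
      (fun α => ENNReal.ofReal (α ^ (q - 3)) * ENNReal.ofReal (‖f v‖ ^ (2 : ℝ))) α
      ≤ ENNReal.ofReal (k ^ (q - 2) / (q - 2)) * ENNReal.ofReal k := by
    rw [lintegral_lintegral_swap, ← hK, ← lintegral_const_mul _ (hm.enorm.pow_const _)]
    · refine lintegral_mono fun v => ?_
      rcases (norm_nonneg (f v)).eq_or_lt with h | h
      · simp [← h, Set.indicator]
      · rw [setLIntegral_split_le h hk hpq hq, ofReal_norm_rpow hpq.nonneg]
    · have hS : MeasurableSet {z : ℝ × V | z.1 * ‖f z.2‖ ^ (p - 1) ≤ k} :=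
        measurableSet_le (by fun_prop) measurable_const
      have : Measurable fun z : ℝ × V =>
        ENNReal.ofReal (z.1 ^ (q - 3)) * ENNReal.ofReal (‖f z.2‖ ^ (2 : ℝ)) := by fun_prop
      exact (this.indicator hS).aemeasurable
  calc _ ≤ ENNReal.ofReal (2 ^ q) * (ENNReal.ofReal q *
        (ENNReal.ofReal (k ^ (q - 2) / (q - 2)) * ENNReal.ofReal k)) := by
        rw [step1]; gcongr; exact step2.trans step3
    _ = _ := by
      rw [hK, ENNReal.ofReal_rpow_of_pos hk, ← ENNReal.ofReal_mul (by positivity),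
        ← ENNReal.ofReal_mul (by linarith), ← ENNReal.ofReal_mul (by positivity),
        ← ENNReal.ofReal.eq_1, ← ENNReal.ofReal_mul hC.le]
      congr 1
      have : k ^ (q - 1) = k ^ (q - 2) * k := by
        rw [← Real.rpow_add_one hk.ne']; congr 1; ring
      rw [this]; ring

end HausdorffYoung

/-! ### Pitt's inequality on the line. -/

theorem enorm_add_sq_le (x y : ℂ) :
    ‖x + y‖ₑ ^ (2 : ℝ) ≤ 2 * ‖x‖ₑ ^ (2 : ℝ) + 2 * ‖y‖ₑ ^ (2 : ℝ) := by
  have h := ENNReal.rpow_add_le_mul_rpow_add_rpow ‖x‖ₑ ‖y‖ₑ (p := 2) (by norm_num)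
  have h2 : (2 : ℝ≥0∞) ^ ((2 : ℝ) - 1) = 2 := by norm_num
  rw [h2, mul_add] at h
  exact (ENNReal.rpow_le_rpow (enorm_add_le x y) zero_le_two).trans h

/-- The cut is now at `‖f‖ ^ p = k Λ`. Plancherel handles the small part; the transform of the large
part is bounded by its `L¹` norm, on an interval of length `2Λ`. -/
theorem setLIntegral_abs_lt_enorm_sq_fourier_le {p k Λ : ℝ} (hk : 0 < k) (hΛ : 0 < Λ) (hp : 1 < p)
    {f : ℝ → ℂ} (hm : Measurable f) (hf : Integrable f) (hf2 : MemLp f 2)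
    (hK : ∫⁻ v, ‖f v‖ₑ ^ p = ENNReal.ofReal k) :
    ∫⁻ w in {w | |w| < Λ}, ‖𝓕 f w‖ₑ ^ (2 : ℝ) ≤
      2 * (∫⁻ v in {v | ‖f v‖ ^ p < k * Λ}, ‖f v‖ₑ ^ (2 : ℝ)) +
      ENNReal.ofReal (4 * k ^ (1 / p) * Λ ^ (1 / p)) *
        ∫⁻ v in {v | ‖f v‖ ^ p < k * Λ}ᶜ, ‖f v‖ₑ := by
  have hp0 : 0 < p := by linarith
  set S : Set ℝ := {v | ‖f v‖ ^ p < k * Λ} with hSdef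
  have hS : MeasurableSet S := measurableSet_lt (hm.norm.pow_const _) measurable_const
  have hkΛ : 0 < k * Λ := mul_pos hk hΛ
  have hbig : ∫⁻ v in Sᶜ, ‖f v‖ₑ ≤ ENNReal.ofReal (k * (k * Λ) ^ (1 / p - 1)) := by
    calc ∫⁻ v in Sᶜ, ‖f v‖ₑ
        ≤ ∫⁻ v in Sᶜ, ENNReal.ofReal ((k * Λ) ^ (1 / p - 1)) * ‖f v‖ₑ ^ p := by
          refine setLIntegral_mono' hS.compl fun v hv => ?_
          have hv' : k * Λ ≤ ‖f v‖ ^ p := not_lt.1 hv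
          rw [← ofReal_norm_rpow hp0.le, ← ENNReal.ofReal_mul (by positivity), ← ofReal_norm]
          refine ENNReal.ofReal_le_ofReal ?_
          have hpos : 0 < ‖f v‖ ^ p := hkΛ.trans_le hv'
          have h1 : (‖f v‖ ^ p) ^ (1 / p - 1) ≤ (k * Λ) ^ (1 / p - 1) := by
            refine Real.rpow_le_rpow_of_nonpos hkΛ hv' ?_
            rw [sub_nonpos, div_le_one hp0]; exact hp.le
          have h2 : (‖f v‖ ^ p) ^ (1 / p - 1) * ‖f v‖ ^ p = ‖f v‖ := by
            rw [← Real.rpow_add_one hpos.ne', ← Real.rpow_mul (norm_nonneg _)]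
            have : p * (1 / p - 1 + 1) = 1 := by field_simp; ring
            rw [this, Real.rpow_one]
          calc ‖f v‖ = (‖f v‖ ^ p) ^ (1 / p - 1) * ‖f v‖ ^ p := h2.symm
            _ ≤ _ := by gcongr
      _ ≤ ∫⁻ v, ENNReal.ofReal ((k * Λ) ^ (1 / p - 1)) * ‖f v‖ₑ ^ p :=
          setLIntegral_le_lintegral _ _
      _ = _ := by
          rw [lintegral_const_mul _ (hm.enorm.pow_const _), hK,
            ← ENNReal.ofReal_mul (by positivity), mul_comm]
  have hvol : volume {w : ℝ | |w| < Λ} = ENNReal.ofReal (2 * Λ) := by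
    have : {w : ℝ | |w| < Λ} = Set.Ioo (-Λ) Λ := by ext w; simp [abs_lt]
    rw [this, Real.volume_Ioo]; congr 1; ring
  have hc1 := (continuous_fourier (hf.indicator hS)).measurable
  calc ∫⁻ w in {w | |w| < Λ}, ‖𝓕 f w‖ₑ ^ (2 : ℝ)
      ≤ ∫⁻ w in {w | |w| < Λ}, (2 * ‖𝓕 (S.indicator f) w‖ₑ ^ (2 : ℝ) +
          2 * (∫⁻ v in Sᶜ, ‖f v‖ₑ) ^ (2 : ℝ)) := by
        refine lintegral_mono fun w => ?_
        rw [fourier_indicator_add_compl hf hS]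
        refine (enorm_add_sq_le _ _).trans ?_
        gcongr
        exact enorm_fourier_indicator_le f hS.compl w
    _ = 2 * (∫⁻ w in {w | |w| < Λ}, ‖𝓕 (S.indicator f) w‖ₑ ^ (2 : ℝ)) +
          2 * (∫⁻ v in Sᶜ, ‖f v‖ₑ) ^ (2 : ℝ) * ENNReal.ofReal (2 * Λ) := by
        rw [lintegral_add_right _ measurable_const, lintegral_const_mul _ (hc1.enorm.pow_const _),
          setLIntegral_const, hvol]
    _ ≤ _ := by
        gcongr ?_ + ?_
        · exact mul_le_mul_right ((setLIntegral_le_lintegral _ _).trans_eq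
            (lintegral_enorm_sq_fourier_indicator hf hf2 hS)) _
        -- Only one of the two `L¹` factors is estimated. The other stays an integral in `v`, so
        -- that the bound can later be integrated in `Λ` pointwise in `v`.
        · have e2 : (∫⁻ v in Sᶜ, ‖f v‖ₑ) ^ (2 : ℝ) ≤
              ENNReal.ofReal (k * (k * Λ) ^ (1 / p - 1)) * ∫⁻ v in Sᶜ, ‖f v‖ₑ := by
            rw [ENNReal.rpow_two, sq]; gcongr
          have e3 : 4 * k ^ (1 / p) * Λ ^ (1 / p) =
              2 * (k * (k * Λ) ^ (1 / p - 1)) * (2 * Λ) := by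
            have h1 : (k * Λ) ^ (1 / p) = (k * Λ) ^ (1 / p - 1) * (k * Λ) := by
              rw [← Real.rpow_add_one hkΛ.ne']; congr 1; ring
            rw [mul_assoc 4, ← Real.mul_rpow hk.le hΛ.le, h1]; ring
          rw [e3, ENNReal.ofReal_mul (p := 2 * (k * (k * Λ) ^ (1 / p - 1))) (by positivity),
            ENNReal.ofReal_mul (q := k * (k * Λ) ^ (1 / p - 1)) (by positivity),
            ENNReal.ofReal_ofNat]
          calc 2 * (∫⁻ v in Sᶜ, ‖f v‖ₑ) ^ (2 : ℝ) * ENNReal.ofReal (2 * Λ)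
              ≤ 2 * (ENNReal.ofReal (k * (k * Λ) ^ (1 / p - 1)) * ∫⁻ v in Sᶜ, ‖f v‖ₑ) *
                ENNReal.ofReal (2 * Λ) := by gcongr
            _ = _ := by ring

/-- Here `a` stands for `‖f v‖`, with threshold `Λ = a ^ p / k`. The first term converges at
infinity because `σ > 0`, the second at `0` because `p > 1`; the choice `σ = 2 / p - 1` makes both
proportional to `k ^ σ * a ^ p`. -/
theorem lintegral_pitt_split {a k p σ : ℝ} (ha : 0 < a) (hk : 0 < k) (hp : 1 < p)
    (hσ : σ = 2 / p - 1) (hσ0 : 0 < σ) :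
    ∫⁻ Λ in Set.Ioi (0 : ℝ),
      ({Λ : ℝ | a ^ p < k * Λ}.indicator
        (fun Λ => ENNReal.ofReal (Λ ^ (-σ - 1)) * ENNReal.ofReal (2 * a ^ (2 : ℝ))) Λ +
      {Λ : ℝ | a ^ p < k * Λ}ᶜ.indicator
        (fun Λ => ENNReal.ofReal (Λ ^ (-(1 / p))) * ENNReal.ofReal (4 * k ^ (1 / p) * a)) Λ)
      = ENNReal.ofReal ((2 / σ + 4 / (1 - 1 / p)) * k ^ σ) * ENNReal.ofReal (a ^ p) := by
  have hp0 : 0 < p := by linarith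
  have h1p : 0 < 1 - 1 / p := by rw [sub_pos, div_lt_one hp0]; exact hp
  have hset : {Λ : ℝ | a ^ p < k * Λ} = Set.Ioi (a ^ p / k) := by
    ext Λ; simp [div_lt_iff₀' hk]
  have hc : 0 < a ^ p / k := by positivity
  have hm : Measurable fun Λ : ℝ => ENNReal.ofReal (Λ ^ (-σ - 1)) *
    ENNReal.ofReal (2 * a ^ (2 : ℝ)) := by fun_prop
  rw [hset, lintegral_add_left (hm.indicator measurableSet_Ioi),
    lintegral_indicator measurableSet_Ioi, lintegral_indicator measurableSet_Ioi.compl,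
    Measure.restrict_restrict measurableSet_Ioi, Measure.restrict_restrict measurableSet_Ioi.compl,
    Set.compl_Ioi, Set.Iic_inter_Ioi, Set.Ioi_inter_Ioi, sup_eq_left.2 hc.le,
    lintegral_mul_const _ (by fun_prop), lintegral_mul_const _ (by fun_prop),
    setLIntegral_Ioc_rpow hc.le (by linarith), setLIntegral_Ioi_rpow hc (by linarith),
    ← ENNReal.ofReal_mul', ← ENNReal.ofReal_mul', ← ENNReal.ofReal_add, ← ENNReal.ofReal_mul']
  · congr 1
    have e1 : -σ - 1 + 1 = -σ := by ring
    have e2 : -(1 / p) + 1 = 1 - 1 / p := by ring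
    have e3 : a ^ (2 : ℝ) / (a ^ p) ^ σ = a ^ p := by
      rw [← Real.rpow_mul ha.le, ← Real.rpow_sub ha]
      congr 1; rw [hσ]; field_simp; ring
    have e4 : k ^ (1 / p) / k ^ (1 - 1 / p) = k ^ σ := by
      rw [← Real.rpow_sub hk]; congr 1; rw [hσ]; ring
    have e5 : (a ^ p) ^ (1 - 1 / p) * a = a ^ p := by
      rw [← Real.rpow_mul ha.le, ← Real.rpow_add_one ha.ne']
      congr 1; field_simp; ring
    rw [e1, e2, Real.rpow_neg hc.le, Real.div_rpow (by positivity) hk.le,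
      Real.div_rpow (by positivity) hk.le]
    have t1 : -((a ^ p) ^ σ / k ^ σ)⁻¹ / -σ * (2 * a ^ (2 : ℝ))
        = 2 / σ * k ^ σ * (a ^ (2 : ℝ) / (a ^ p) ^ σ) := by
      rw [neg_div_neg_eq, inv_div]; ring
    have t2 : (a ^ p) ^ (1 - 1 / p) / k ^ (1 - 1 / p) / (1 - 1 / p) * (4 * k ^ (1 / p) * a)
        = 4 / (1 - 1 / p) * (k ^ (1 / p) / k ^ (1 - 1 / p)) * ((a ^ p) ^ (1 - 1 / p) * a) := by
      ring
    rw [t1, t2, e3, e4, e5]; ring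
  · positivity
  · have : -σ - 1 + 1 = -σ := by ring
    rw [this, neg_div_neg_eq]; positivity
  · have : -(1 / p) + 1 = 1 - 1 / p := by ring
    rw [this]; positivity
  · positivity
  · positivity

theorem ofReal_abs_rpow_neg_eq {σ w : ℝ} (hσ : 0 < σ) (hw : w ≠ 0) :
    ENNReal.ofReal (|w| ^ (-σ)) = ENNReal.ofReal σ * ∫⁻ Λ in Set.Ioi (0 : ℝ),
      {Λ : ℝ | |w| < Λ}.indicator (fun Λ => ENNReal.ofReal (Λ ^ (-σ - 1))) Λ := by
  have hw' : 0 < |w| := abs_pos.2 hw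
  have hset : {Λ : ℝ | |w| < Λ} = Set.Ioi |w| := rfl
  rw [hset, lintegral_indicator measurableSet_Ioi, Measure.restrict_restrict measurableSet_Ioi,
    Set.Ioi_inter_Ioi, sup_eq_left.2 hw'.le, setLIntegral_Ioi_rpow hw' (by linarith),
    ← ENNReal.ofReal_mul hσ.le]
  congr 1
  rw [sub_add_cancel, neg_div_neg_eq]
  field_simp

/-- Pitt's inequality in dimension one, from `L^p` to a weighted `L²` space. -/
theorem pitt_inequality {p σ : ℝ} (hp : 1 < p) (hσ : σ = 2 / p - 1) (hσ0 : 0 < σ) :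
    ∃ C : ℝ≥0, ∀ f : ℝ → ℂ, Measurable f → Integrable f → MemLp f 2 →
      ∫⁻ w, ENNReal.ofReal (|w| ^ (-σ)) * ‖𝓕 f w‖ₑ ^ (2 : ℝ) ≤
        C * (∫⁻ v, ‖f v‖ₑ ^ p) ^ (2 / p) := by
  have hp0 : 0 < p := by linarith
  have h1p : 0 < 1 - 1 / p := by rw [sub_pos, div_lt_one hp0]; exact hp
  -- The outer `σ` comes from writing `|w| ^ (-σ)` as an integral over `Λ > |w|`; the bracket is the
  -- constant of `lintegral_pitt_split`.
  refine ⟨Real.toNNReal (σ * (2 / σ + 4 / (1 - 1 / p))), fun f hm hf hf2 => ?_⟩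
  have hC : 0 < σ * (2 / σ + 4 / (1 - 1 / p)) := by positivity
  rcases eq_or_ne (∫⁻ v, ‖f v‖ₑ ^ p) 0 with h0 | h0
  · have h0' : f =ᵐ[volume] 0 := by
      rw [lintegral_eq_zero_iff (hm.enorm.pow_const _)] at h0
      filter_upwards [h0] with v hv
      simpa [hp0] using hv
    have hz : ∀ w, 𝓕 f w = 0 := fun w => by
      rw [Real.fourier_eq]
      refine integral_eq_zero_of_ae ?_
      filter_upwards [h0'] with v hv
      simp [hv]
    simp [hz]
  rcases eq_or_ne (∫⁻ v, ‖f v‖ₑ ^ p) ∞ with hi | hi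
  · rw [hi, ENNReal.top_rpow_of_pos (by positivity), ENNReal.mul_top]
    · exact le_top
    · simpa using hC
  obtain ⟨k, hk, hK⟩ : ∃ k : ℝ, 0 < k ∧ ∫⁻ v, ‖f v‖ₑ ^ p = ENNReal.ofReal k :=
    ⟨_, ENNReal.toReal_pos h0 hi, (ENNReal.ofReal_toReal hi).symm⟩
  have hcm : Measurable (𝓕 f) := (continuous_fourier hf).measurable
  have hms : MeasurableSet {z : ℝ × ℝ | |z.1| < z.2} :=
    measurableSet_lt (by fun_prop) (by fun_prop)
  have hmeas : Measurable fun z : ℝ × ℝ =>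
      {Λ : ℝ | |z.1| < Λ}.indicator (fun Λ => ENNReal.ofReal (Λ ^ (-σ - 1))) z.2 *
        ‖𝓕 f z.1‖ₑ ^ (2 : ℝ) := by
    have h1 : Measurable fun z : ℝ × ℝ => ENNReal.ofReal (z.2 ^ (-σ - 1)) := by fun_prop
    exact (h1.indicator hms).mul ((hcm.comp measurable_fst).enorm.pow_const _)
  have step1 : ∫⁻ w, ENNReal.ofReal (|w| ^ (-σ)) * ‖𝓕 f w‖ₑ ^ (2 : ℝ) =
      ENNReal.ofReal σ * ∫⁻ Λ in Set.Ioi (0 : ℝ), ENNReal.ofReal (Λ ^ (-σ - 1)) *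
        ∫⁻ w in {w | |w| < Λ}, ‖𝓕 f w‖ₑ ^ (2 : ℝ) := by
    calc _ = ∫⁻ w, ENNReal.ofReal σ * ∫⁻ Λ in Set.Ioi (0 : ℝ),
          {Λ : ℝ | |w| < Λ}.indicator (fun Λ => ENNReal.ofReal (Λ ^ (-σ - 1))) Λ *
            ‖𝓕 f w‖ₑ ^ (2 : ℝ) := by
          refine lintegral_congr_ae ?_
          filter_upwards [compl_mem_ae_iff.2 (measure_singleton (0 : ℝ))] with w hw
          rw [ofReal_abs_rpow_neg_eq hσ0 hw, mul_assoc, lintegral_mul_const]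
          have h1 : Measurable fun Λ : ℝ => ENNReal.ofReal (Λ ^ (-σ - 1)) := by fun_prop
          exact h1.indicator measurableSet_Ioi
      _ = _ := by
          rw [lintegral_const_mul _ (Measurable.lintegral_prod_right' hmeas),
            lintegral_lintegral_swap hmeas.aemeasurable]
          congr 1
          refine lintegral_congr fun Λ => ?_
          have hΛm : MeasurableSet {w : ℝ | |w| < Λ} := measurableSet_lt (by fun_prop) (by fun_prop)
          rw [← lintegral_indicator hΛm, ← lintegral_const_mul _ ((hcm.enorm.pow_const _).indicator hΛm)]
          refine lintegral_congr fun w => ?_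
          by_cases h : |w| < Λ
          · rw [Set.indicator_of_mem (by exact h), Set.indicator_of_mem (by exact h)]
          · rw [Set.indicator_of_notMem (by exact h), Set.indicator_of_notMem (by exact h)]; simp
  have step2 : ∫⁻ Λ in Set.Ioi (0 : ℝ), ENNReal.ofReal (Λ ^ (-σ - 1)) *
        ∫⁻ w in {w | |w| < Λ}, ‖𝓕 f w‖ₑ ^ (2 : ℝ) ≤
      ∫⁻ Λ in Set.Ioi (0 : ℝ), ∫⁻ v, ({Λ : ℝ | ‖f v‖ ^ p < k * Λ}.indicator
        (fun Λ => ENNReal.ofReal (Λ ^ (-σ - 1)) * ENNReal.ofReal (2 * ‖f v‖ ^ (2 : ℝ))) Λ +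
      {Λ : ℝ | ‖f v‖ ^ p < k * Λ}ᶜ.indicator
        (fun Λ => ENNReal.ofReal (Λ ^ (-(1 / p))) * ENNReal.ofReal (4 * k ^ (1 / p) * ‖f v‖)) Λ) := by
    refine setLIntegral_mono' measurableSet_Ioi fun Λ hΛ => ?_
    have hΛ : 0 < Λ := hΛ
    have hS : MeasurableSet {v | ‖f v‖ ^ p < k * Λ} :=
      measurableSet_lt (hm.norm.pow_const _) measurable_const
    refine (mul_le_mul_right
      (setLIntegral_abs_lt_enorm_sq_fourier_le hk hΛ hp hm hf hf2 hK) _).trans_eq ?_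
    rw [mul_add, ← mul_assoc, ← mul_assoc, ← lintegral_indicator hS, ← lintegral_indicator hS.compl,
      ← lintegral_const_mul _ ((hm.enorm.pow_const _).indicator hS),
      ← lintegral_const_mul _ (hm.enorm.indicator hS.compl), ← lintegral_add_left
        (((hm.enorm.pow_const _).indicator hS).const_mul _)]
    refine lintegral_congr fun v => ?_
    have e : Λ ^ (-σ - 1) * (4 * k ^ (1 / p) * Λ ^ (1 / p)) =
        Λ ^ (-(1 / p)) * (4 * k ^ (1 / p)) := by
      have : Λ ^ (-(1 / p)) = Λ ^ (-σ - 1) * Λ ^ (1 / p) := by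
        rw [← Real.rpow_add hΛ]; congr 1; rw [hσ]; ring
      rw [this]; ring
    by_cases hv : ‖f v‖ ^ p < k * Λ
    · have hv1 : v ∈ {v | ‖f v‖ ^ p < k * Λ} := hv
      have hv2 : Λ ∈ {Λ : ℝ | ‖f v‖ ^ p < k * Λ} := hv
      rw [Set.indicator_of_mem hv1, Set.indicator_of_mem hv2,
        Set.indicator_of_notMem (Set.notMem_compl_iff.2 hv1),
        Set.indicator_of_notMem (Set.notMem_compl_iff.2 hv2), mul_zero,
        ENNReal.ofReal_mul (by norm_num), ofReal_norm_rpow zero_le_two, ENNReal.ofReal_ofNat,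
        mul_assoc]
    · have hv1 : v ∉ {v | ‖f v‖ ^ p < k * Λ} := hv
      have hv2 : Λ ∉ {Λ : ℝ | ‖f v‖ ^ p < k * Λ} := hv
      rw [Set.indicator_of_notMem hv1, Set.indicator_of_notMem hv2,
        Set.indicator_of_mem (Set.mem_compl hv1), Set.indicator_of_mem (Set.mem_compl hv2),
        mul_zero, ← ENNReal.ofReal_mul (by positivity), e,
        ENNReal.ofReal_mul (p := 4 * k ^ (1 / p)) (by positivity), ofReal_norm,
        ENNReal.ofReal_mul (by positivity), mul_assoc]
  have hmS : MeasurableSet {z : ℝ × ℝ | ‖f z.2‖ ^ p < k * z.1} :=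
    measurableSet_lt (by fun_prop) (by fun_prop)
  have step3 : ∫⁻ Λ in Set.Ioi (0 : ℝ), ∫⁻ v, ({Λ : ℝ | ‖f v‖ ^ p < k * Λ}.indicator
        (fun Λ => ENNReal.ofReal (Λ ^ (-σ - 1)) * ENNReal.ofReal (2 * ‖f v‖ ^ (2 : ℝ))) Λ +
      {Λ : ℝ | ‖f v‖ ^ p < k * Λ}ᶜ.indicator
        (fun Λ => ENNReal.ofReal (Λ ^ (-(1 / p))) * ENNReal.ofReal (4 * k ^ (1 / p) * ‖f v‖)) Λ) ≤
      ENNReal.ofReal ((2 / σ + 4 / (1 - 1 / p)) * k ^ σ) * ENNReal.ofReal k := by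
    rw [lintegral_lintegral_swap, ← hK, ← lintegral_const_mul _ (hm.enorm.pow_const _)]
    · refine lintegral_mono fun v => ?_
      rcases (norm_nonneg (f v)).eq_or_lt with h | h
      · simp [← h, Set.indicator]
      · rw [lintegral_pitt_split h hk hp hσ hσ0, ofReal_norm_rpow hp0.le]
    · have h1 : Measurable fun z : ℝ × ℝ =>
        ENNReal.ofReal (z.1 ^ (-σ - 1)) * ENNReal.ofReal (2 * ‖f z.2‖ ^ (2 : ℝ)) := by fun_prop
      have h2 : Measurable fun z : ℝ × ℝ => ENNReal.ofReal (z.1 ^ (-(1 / p))) *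
        ENNReal.ofReal (4 * k ^ (1 / p) * ‖f z.2‖) := by fun_prop
      exact ((h1.indicator hmS).add (h2.indicator hmS.compl)).aemeasurable
  calc _ ≤ ENNReal.ofReal σ *
        (ENNReal.ofReal ((2 / σ + 4 / (1 - 1 / p)) * k ^ σ) * ENNReal.ofReal k) := by
        rw [step1]; gcongr; exact step2.trans step3
    _ = _ := by
      rw [hK, ENNReal.ofReal_rpow_of_pos hk, ← ENNReal.ofReal_mul (by positivity),
        ← ENNReal.ofReal_mul (by linarith), ← ENNReal.ofReal.eq_1, ← ENNReal.ofReal_mul hC.le]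
      congr 1
      have : k ^ (2 / p) = k ^ σ * k := by
        rw [← Real.rpow_add_one hk.ne']; congr 1; rw [hσ]; ring
      rw [this]; ring

/-! ### Truncation, duality of norms and Minkowski's integral inequality. -/

section Truncation

variable {α : Type*}

/-- The truncation of `F` to values at most `m` and to the set `S m`. -/
def truncation (S : ℕ → Set α) (F : α → ℝ≥0∞) (m : ℕ) : α → ℝ≥0∞ :=
  (S m).indicator fun x => min (F x) m

theorem truncation_le (S : ℕ → Set α) (F : α → ℝ≥0∞) (m : ℕ) (x : α) :
    truncation S F m x ≤ F x :=
  (Set.indicator_le_self' (fun _ _ => zero_le) x).trans (min_le_left _ _)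

theorem truncation_le_natCast (S : ℕ → Set α) (F : α → ℝ≥0∞) (m : ℕ) (x : α) :
    truncation S F m x ≤ m :=
  (Set.indicator_le_self' (fun _ _ => zero_le) x).trans (min_le_right _ _)

theorem monotone_truncation {S : ℕ → Set α} (hS : Monotone S) (F : α → ℝ≥0∞) :
    Monotone (truncation S F) := by
  intro m n hmn x
  refine (Set.indicator_le_indicator_of_subset (hS hmn) (fun _ => zero_le) x).trans ?_
  refine Set.indicator_le_indicator ?_
  gcongr

theorem iSup_truncation {S : ℕ → Set α} (hS : Monotone S) (hU : ∀ x, ∃ m, x ∈ S m)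
    (F : α → ℝ≥0∞) (x : α) : ⨆ m, truncation S F m x = F x := by
  refine le_antisymm (iSup_le fun m => truncation_le S F m x) ?_
  obtain ⟨m₀, hm₀⟩ := hU x
  refine le_of_forall_lt fun c hc => ?_
  obtain ⟨k, hk⟩ := ENNReal.exists_nat_gt (hc.trans_le le_top).ne
  have hmem : x ∈ S (max m₀ k) := hS (le_max_left _ _) hm₀
  refine lt_of_lt_of_le ?_ (le_iSup (fun m => truncation S F m x) (max m₀ k))
  rw [truncation, Set.indicator_of_mem hmem]
  refine lt_min hc (hk.trans_le ?_)
  exact_mod_cast le_max_right _ _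

theorem measurable_truncation [MeasurableSpace α] {S : ℕ → Set α} (hS : ∀ m, MeasurableSet (S m))
    {F : α → ℝ≥0∞} (hF : Measurable F) (m : ℕ) : Measurable (truncation S F m) :=
  (hF.min measurable_const).indicator (hS m)

end Truncation

/-- The factor `I ^ (1 / s)` is cancelled, which needs `I` finite; this is why the duality argument
works with truncations. -/
theorem le_of_le_mul_rpow {I K : ℝ≥0∞} {r s : ℝ} (hrs : r.HolderConjugate s) (hI : I ≠ ∞)
    (h : I ≤ K * I ^ (1 / s)) : I ^ (1 / r) ≤ K := by
  rcases eq_or_ne I 0 with h0 | h0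
  · rw [h0, ENNReal.zero_rpow_of_pos (one_div_pos.2 hrs.pos)]; exact zero_le
  have hs : I ^ (1 / s) ≠ 0 := by simp [h0, hI]
  have hs' : I ^ (1 / s) ≠ ∞ := by simp [h0, hI]
  have e : I ^ (1 / r) * I ^ (1 / s) = I := by
    rw [← ENNReal.rpow_add _ _ h0 hI, one_div, one_div, hrs.inv_add_inv_eq_one, ENNReal.rpow_one]
  rw [← e] at h
  exact (ENNReal.mul_le_mul_iff_left hs hs').1 (by rwa [e] at h ⊢)

/-- The converse of Hölder's inequality: the `L^r` norm is controlled by duality. -/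
theorem lintegral_rpow_le_of_duality {α : Type*} [MeasurableSpace α] {μ : Measure α}
    [SigmaFinite μ] {r s : ℝ} (hrs : r.HolderConjugate s) {F : α → ℝ≥0∞} (hF : Measurable F)
    {K : ℝ≥0∞}
    (h : ∀ w : α → ℝ≥0∞, Measurable w → ∫⁻ x, F x * w x ∂μ ≤ K * (∫⁻ x, w x ^ s ∂μ) ^ (1 / s)) :
    (∫⁻ x, F x ^ r ∂μ) ^ (1 / r) ≤ K := by
  have hr := hrs.pos
  set S := spanningSets μ
  have hSm := monotone_spanningSets μ
  have hSU : ∀ x, ∃ m, x ∈ S m := fun x =>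
    Set.mem_iUnion.1 ((iUnion_spanningSets μ).symm ▸ Set.mem_univ x)
  have hFm := fun m => measurable_truncation (measurableSet_spanningSets μ) hF m
  have key : ∀ m, (∫⁻ x, truncation S F m x ^ r ∂μ) ^ (1 / r) ≤ K := by
    intro m
    refine le_of_le_mul_rpow hrs ?_ ?_
    · have : ∫⁻ x, truncation S F m x ^ r ∂μ ≤ ∫⁻ x, (S m).indicator (fun _ => (m : ℝ≥0∞) ^ r) x ∂μ := by
        refine lintegral_mono fun x => ?_
        by_cases hx : x ∈ S m
        · rw [Set.indicator_of_mem hx]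
          gcongr
          exact truncation_le_natCast _ _ _ _
        · simp [truncation, hx, hr]
      refine ne_top_of_le_ne_top ?_ this
      rw [lintegral_indicator_const (measurableSet_spanningSets μ m)]
      exact ENNReal.mul_ne_top (by simp [hr.le])
        (measure_spanningSets_lt_top μ m).ne
    -- The extremal function of Hölder's inequality for the truncation: its `s`-th power is the
    -- `r`-th power of the truncation.
    · have hle := h (fun x => truncation S F m x ^ (r - 1)) ((hFm m).pow_const (r - 1))
      have e1 : ∀ x, (truncation S F m x ^ (r - 1)) ^ s = truncation S F m x ^ r := fun x => by
        rw [← ENNReal.rpow_mul, hrs.sub_one_mul_conj]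
      simp only [e1] at hle
      refine le_trans (lintegral_mono fun x => ?_) hle
      have e2 : truncation S F m x ^ r = truncation S F m x * truncation S F m x ^ (r - 1) := by
        have := ENNReal.rpow_add_of_nonneg (x := truncation S F m x) 1 (r - 1) zero_le_one
          hrs.sub_one_pos.le
        rw [ENNReal.rpow_one] at this
        rw [← this]; congr 1; ring
      rw [e2]
      gcongr
      exact truncation_le _ _ _ _
  have hsup : ∫⁻ x, F x ^ r ∂μ = ⨆ m, ∫⁻ x, truncation S F m x ^ r ∂μ := by
    rw [← lintegral_iSup (fun m => (hFm m).pow_const r)]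
    · refine lintegral_congr fun x => ?_
      rw [← iSup_truncation hSm hSU F x]
      exact (ENNReal.orderIsoRpow r hr).map_iSup _
    · intro m n hmn x
      exact ENNReal.rpow_le_rpow (monotone_truncation hSm F hmn x) hr.le
  rw [hsup, one_div, ENNReal.rpow_inv_le_iff hr]
  refine iSup_le fun m => ?_
  rw [← ENNReal.rpow_inv_le_iff hr, ← one_div]
  exact key m

/-- Minkowski's integral inequality. -/
theorem lintegral_rpow_lintegral_le {α β : Type*} [MeasurableSpace α] [MeasurableSpace β]
    {μ : Measure α} {ν : Measure β} [SFinite μ] [SigmaFinite ν] {r s : ℝ}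
    (hrs : r.HolderConjugate s) {u : α → β → ℝ≥0∞} (hu : Measurable (Function.uncurry u)) :
    (∫⁻ y, (∫⁻ x, u x y ∂μ) ^ r ∂ν) ^ (1 / r) ≤ ∫⁻ x, (∫⁻ y, u x y ^ r ∂ν) ^ (1 / r) ∂μ := by
  -- Against a test function `w`, Tonelli brings the `y` integral inside and Hölder applies for each
  -- fixed `x`.
  refine lintegral_rpow_le_of_duality hrs hu.lintegral_prod_left' fun w hw => ?_
  calc ∫⁻ y, (∫⁻ x, u x y ∂μ) * w y ∂ν = ∫⁻ y, ∫⁻ x, u x y * w y ∂μ ∂ν := by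
        refine lintegral_congr fun y => ?_
        exact (lintegral_mul_const (w y) (hu.comp measurable_prodMk_right)).symm
    _ = ∫⁻ x, ∫⁻ y, u x y * w y ∂ν ∂μ := by
        rw [lintegral_lintegral_swap]
        exact ((hu.comp measurable_swap).mul (hw.comp measurable_fst)).aemeasurable
    _ ≤ ∫⁻ x, (∫⁻ y, u x y ^ r ∂ν) ^ (1 / r) * (∫⁻ y, w y ^ s ∂ν) ^ (1 / s) ∂μ := by
        refine lintegral_mono fun x => ?_
        exact ENNReal.lintegral_mul_le_Lp_mul_Lq ν hrs (hu.comp measurable_prodMk_left).aemeasurable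
          hw.aemeasurable
    _ = _ := by
        rw [lintegral_mul_const]
        refine Measurable.pow_const ?_ _
        exact (hu.pow_const r).lintegral_prod_right'

/-! ### Bounded functions of bounded support: vertical Fourier transform and Parseval for the
pairing. -/

theorem memLp_of_bound_of_support {α : Type*} [MeasurableSpace α] {μ : Measure α} {f : α → ℂ}
    (hm : Measurable f) {M : ℝ} (hM : ∀ x, ‖f x‖ ≤ M) {S : Set α} (hS : MeasurableSet S)
    (hμ : μ S ≠ ∞) (hsupp : ∀ x, x ∉ S → f x = 0) (s : ℝ≥0∞) : MemLp f s μ := by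
  refine (memLp_indicator_const s hS M (Or.inr hμ)).mono hm.aestronglyMeasurable
    (Filter.Eventually.of_forall fun x => ?_)
  by_cases hx : x ∈ S
  · rw [Set.indicator_of_mem hx]
    exact (hM x).trans (le_abs_self M)
  · simp [hsupp x hx]

variable {V : Type*} [NormedAddCommGroup V] [InnerProductSpace ℝ V] [FiniteDimensional ℝ V]
  [MeasurableSpace V] [BorelSpace V]

/-- Bounded measurable functions on `V × ℝ` that vanish outside a bounded set. -/
structure BoundedSupported (g : V × ℝ → ℝ) : Prop where
  measurable : Measurable g
  exists_bound : ∃ M, ∀ z, |g z| ≤ M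
  exists_support : ∃ R, ∀ y t, g (y, t) ≠ 0 → ‖y‖ ≤ R ∧ |t| ≤ R

/-- The Fourier transform of `g` in the last variable. -/
def verticalFourier (g : V × ℝ → ℝ) (y : V) (l : ℝ) : ℂ := 𝓕 (fun t => (g (y, t) : ℂ)) l

namespace BoundedSupported

variable {g w : V × ℝ → ℝ}

theorem measurable_slice (hg : BoundedSupported g) (y : V) (c : ℝ) :
    Measurable fun t => (g (y, t + c) : ℂ) :=
  Complex.measurable_ofReal.comp (hg.measurable.comp (by fun_prop))

theorem memLp_slice (hg : BoundedSupported g) (y : V) (c : ℝ) (s : ℝ≥0∞) :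
    MemLp (fun t => (g (y, t + c) : ℂ)) s := by
  obtain ⟨M, hM⟩ := hg.exists_bound
  obtain ⟨R, hR⟩ := hg.exists_support
  refine memLp_of_bound_of_support (hg.measurable_slice y c) (M := M) (fun t => ?_)
    (S := Set.Icc (-R - c) (R - c)) measurableSet_Icc (by simp) (fun t ht => ?_) s
  · simpa using hM (y, t + c)
  · by_contra h
    have := abs_le.1 (hR y (t + c) (by exact_mod_cast h)).2
    exact ht ⟨by linarith, by linarith⟩

theorem integrable_slice (hg : BoundedSupported g) (y : V) (c : ℝ) :
    Integrable fun t => (g (y, t + c) : ℂ) :=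
  memLp_one_iff_integrable.1 (hg.memLp_slice y c 1)

theorem memLp_slice_zero (hg : BoundedSupported g) (y : V) (s : ℝ≥0∞) :
    MemLp (fun t => (g (y, t) : ℂ)) s := by
  simpa using hg.memLp_slice y 0 s

theorem integrable_slice_zero (hg : BoundedSupported g) (y : V) :
    Integrable fun t => (g (y, t) : ℂ) :=
  memLp_one_iff_integrable.1 (hg.memLp_slice_zero y 1)

theorem measurable_slice_zero (hg : BoundedSupported g) (y : V) :
    Measurable fun t => (g (y, t) : ℂ) := by
  simpa using hg.measurable_slice y 0

theorem measurable_verticalFourier (hg : BoundedSupported g) :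
    Measurable (Function.uncurry (verticalFourier g)) := by
  have h : StronglyMeasurable fun z : (V × ℝ) × ℝ =>
      Complex.exp (↑(-2 * Real.pi * inner ℝ z.2 z.1.2) * Complex.I) • (g (z.1.1, z.2) : ℂ) := by
    have h1 : Measurable fun z : (V × ℝ) × ℝ => (g (z.1.1, z.2) : ℂ) :=
      Complex.measurable_ofReal.comp (hg.measurable.comp (by fun_prop))
    have h2 : Continuous fun z : (V × ℝ) × ℝ =>
      Complex.exp (↑(-2 * Real.pi * inner ℝ z.2 z.1.2) * Complex.I) := by fun_prop
    exact (h2.measurable.smul h1).stronglyMeasurable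
  convert (h.integral_prod_right' (ν := (volume : Measure ℝ))).measurable using 1
  ext z
  rw [Function.uncurry, verticalFourier, Real.fourier_eq']

theorem verticalFourier_eq_zero {R : ℝ} (hR : ∀ y t, g (y, t) ≠ 0 → ‖y‖ ≤ R ∧ |t| ≤ R)
    {y : V} (hy : R < ‖y‖) (l : ℝ) : verticalFourier g y l = 0 := by
  have : (fun t => (g (y, t) : ℂ)) = 0 := by
    ext t
    by_contra h
    exact hy.not_ge (hR y t (fun h0 => h (by simp [h0]))).1
  rw [verticalFourier, this, Real.fourier_eq]
  simp

theorem exists_norm_verticalFourier_le (hg : BoundedSupported g) :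
    ∃ B, ∀ y l, ‖verticalFourier g y l‖ ≤ B := by
  obtain ⟨M, hM⟩ := hg.exists_bound
  obtain ⟨R, hR⟩ := hg.exists_support
  refine ⟨∫ t, (Set.Icc (-R) R).indicator (fun _ => M) t, fun y l => ?_⟩
  refine (norm_fourier_le _ l).trans (integral_mono (hg.integrable_slice_zero y).norm ?_ fun t => ?_)
  · exact (integrable_indicator_iff measurableSet_Icc).2 (integrableOn_const (by simp))
  · by_cases ht : t ∈ Set.Icc (-R) R
    · simpa [Set.indicator_of_mem ht] using hM (y, t)
    · have : g (y, t) = 0 := by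
        by_contra h
        exact ht (abs_le.1 (hR y t h).2)
      simp [Set.indicator_of_notMem ht, this]

theorem memLp_verticalFourier (hg : BoundedSupported g) (l : ℝ) (s : ℝ≥0∞) :
    MemLp (fun y => verticalFourier g y l) s := by
  obtain ⟨B, hB⟩ := hg.exists_norm_verticalFourier_le
  obtain ⟨R, hR⟩ := hg.exists_support
  refine memLp_of_bound_of_support (hg.measurable_verticalFourier.comp measurable_prodMk_right)
    (fun y => hB y l) (S := Metric.closedBall 0 R) measurableSet_closedBall
    measure_closedBall_lt_top.ne (fun y hy => ?_) s
  refine verticalFourier_eq_zero hR ?_ l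
  simpa using hy

theorem integrable_verticalFourier (hg : BoundedSupported g) (l : ℝ) :
    Integrable fun y => verticalFourier g y l :=
  memLp_one_iff_integrable.1 (hg.memLp_verticalFourier l 1)

/-- Cauchy-Schwarz on the ball that contains the support in `y`, then Plancherel in `t` for each
`y`. This is the finiteness that justifies Fubini in `integrable_pairingFourier`. -/
theorem lintegral_lintegral_verticalFourier_sq_lt_top (hg : BoundedSupported g) :
    ∫⁻ l, (∫⁻ y, ‖verticalFourier g y l‖ₑ) ^ (2 : ℝ) < ∞ := by
  obtain ⟨M, hM⟩ := hg.exists_bound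
  obtain ⟨R, hR⟩ := hg.exists_support
  set B : Set V := Metric.closedBall 0 R
  have hB : volume B ≠ ∞ := measure_closedBall_lt_top.ne
  have hmv := hg.measurable_verticalFourier
  have h1 : ∀ l, (∫⁻ y, ‖verticalFourier g y l‖ₑ) ^ (2 : ℝ) ≤
      volume B * ∫⁻ y, ‖verticalFourier g y l‖ₑ ^ (2 : ℝ) := by
    intro l
    have hml : Measurable fun y => ‖verticalFourier g y l‖ₑ :=
      (hmv.comp measurable_prodMk_right).enorm
    have h := ENNReal.lintegral_mul_le_Lp_mul_Lq volume Real.HolderConjugate.two_two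
      (f := B.indicator fun _ => 1) (g := fun y => ‖verticalFourier g y l‖ₑ)
      (measurable_const.indicator measurableSet_closedBall).aemeasurable hml.aemeasurable
    have e1 : ∫⁻ y, ((B.indicator (fun _ => 1) : V → ℝ≥0∞) *
        fun y => ‖verticalFourier g y l‖ₑ) y =
        ∫⁻ y, ‖verticalFourier g y l‖ₑ := by
      refine lintegral_congr fun y => ?_
      by_cases hy : y ∈ B
      · simp [Set.indicator_of_mem hy]
      · simp [Set.indicator_of_notMem hy,
          verticalFourier_eq_zero hR (y := y) (by simpa [B] using hy) l]
    have e2 : ∫⁻ y, (B.indicator (fun _ => 1) y : ℝ≥0∞) ^ (2 : ℝ) = volume B := by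
      rw [← lintegral_indicator_one measurableSet_closedBall]
      refine lintegral_congr fun y => ?_
      by_cases hy : y ∈ B
      · simp [B, Set.indicator_of_mem hy]
      · simp [B, Set.indicator_of_notMem hy]
    rw [e1, e2] at h
    refine (ENNReal.rpow_le_rpow h zero_le_two).trans_eq ?_
    rw [ENNReal.mul_rpow_of_nonneg _ _ zero_le_two, ← ENNReal.rpow_mul, ← ENNReal.rpow_mul]
    norm_num
  refine (lintegral_mono h1).trans_lt ?_
  have hm2 : Measurable fun l => ∫⁻ y, ‖verticalFourier g y l‖ₑ ^ (2 : ℝ) :=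
    Measurable.lintegral_prod_left' (f := fun z : V × ℝ => ‖verticalFourier g z.1 z.2‖ₑ ^ (2 : ℝ))
      (hmv.enorm.pow_const _)
  rw [lintegral_const_mul _ hm2]
  refine ENNReal.mul_lt_top hB.lt_top ?_
  rw [lintegral_lintegral_swap ((hmv.comp measurable_swap).enorm.pow_const _).aemeasurable]
  have h2 : ∀ y, ∫⁻ l, ‖verticalFourier g y l‖ₑ ^ (2 : ℝ) ≤
      B.indicator (fun _ => ENNReal.ofReal M ^ (2 : ℝ) * volume (Set.Icc (-R) R)) y := by
    intro y
    by_cases hy : y ∈ B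
    · rw [Set.indicator_of_mem hy]
      simp only [verticalFourier]
      rw [lintegral_enorm_sq_fourier (hg.integrable_slice_zero y) (hg.memLp_slice_zero y 2)]
      rw [← lintegral_indicator_const measurableSet_Icc]
      refine lintegral_mono fun t => ?_
      by_cases ht : t ∈ Set.Icc (-R) R
      · rw [Set.indicator_of_mem ht, ← ofReal_norm]
        gcongr
        simpa using hM (y, t)
      · have : g (y, t) = 0 := by
          by_contra h
          exact ht (abs_le.1 (hR y t h).2)
        simp [this]
    · have := fun l => verticalFourier_eq_zero hR (y := y) (by simpa [B] using hy) l
      simp [this]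
  refine (lintegral_mono h2).trans_lt ?_
  rw [lintegral_indicator_const measurableSet_closedBall]
  refine ENNReal.mul_lt_top (ENNReal.mul_lt_top ?_ ?_) hB.lt_top
  · simp
  · simp

end BoundedSupported

/-- The Fourier side of the pairing `⟨R g, w⟩`, where `R g (x, t) = ∫ g (y, t + ⟪x, y⟫) dy`. -/
def pairingFourier (g w : V × ℝ → ℝ) (x y : V) (l : ℝ) : ℂ :=
  conj (verticalFourier w x l) * (Real.fourierChar (inner ℝ x y * l) • verticalFourier g y l)

namespace BoundedSupported

variable {g w : V × ℝ → ℝ}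

theorem measurable_pairingFourier (hg : BoundedSupported g) (hw : BoundedSupported w) :
    Measurable fun z : (V × V) × ℝ => pairingFourier g w z.1.1 z.1.2 z.2 := by
  have h1 : Measurable fun z : (V × V) × ℝ => verticalFourier w z.1.1 z.2 :=
    hw.measurable_verticalFourier.comp
      (g := Function.uncurry (verticalFourier w)) (f := fun z : (V × V) × ℝ => (z.1.1, z.2))
      (by fun_prop)
  have h2 : Measurable fun z : (V × V) × ℝ => verticalFourier g z.1.2 z.2 :=
    hg.measurable_verticalFourier.comp
      (g := Function.uncurry (verticalFourier g)) (f := fun z : (V × V) × ℝ => (z.1.2, z.2))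
      (by fun_prop)
  have h3 : Measurable fun z : (V × V) × ℝ =>
      (Real.fourierChar (inner ℝ z.1.1 z.1.2 * z.2) : ℂ) := by
    refine Continuous.measurable ?_
    exact continuous_subtype_val.comp (Real.continuous_fourierChar.comp (by fun_prop))
  exact (Complex.continuous_conj.measurable.comp h1).mul (h3.mul h2)

theorem enorm_pairingFourier (x y : V) (l : ℝ) :
    ‖pairingFourier g w x y l‖ₑ = ‖verticalFourier w x l‖ₑ * ‖verticalFourier g y l‖ₑ := by
  have h1 (z : Circle) : ‖(z : ℂ)‖ₑ = 1 := by rw [← ofReal_norm, Circle.norm_coe]; simp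
  rw [pairingFourier, enorm_mul, Circle.smul_def, smul_eq_mul, enorm_mul, h1, one_mul,
    ← ofReal_norm, RCLike.norm_conj, ofReal_norm]

/-- The character has modulus one, so the norm factors in `x` and `y` at fixed `l`; Cauchy-Schwarz
in `l` does the rest. -/
theorem integrable_pairingFourier (hg : BoundedSupported g) (hw : BoundedSupported w) :
    Integrable fun z : (V × V) × ℝ => pairingFourier g w z.1.1 z.1.2 z.2 := by
  refine ⟨(hg.measurable_pairingFourier hw).aestronglyMeasurable, ?_⟩
  have hmg := hg.measurable_verticalFourier
  have hmw := hw.measurable_verticalFourier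
  have ha : Measurable fun l => ∫⁻ x, ‖verticalFourier w x l‖ₑ :=
    Measurable.lintegral_prod_left' (f := fun z : V × ℝ => ‖verticalFourier w z.1 z.2‖ₑ) hmw.enorm
  have hb : Measurable fun l => ∫⁻ y, ‖verticalFourier g y l‖ₑ :=
    Measurable.lintegral_prod_left' (f := fun z : V × ℝ => ‖verticalFourier g z.1 z.2‖ₑ) hmg.enorm
  rw [HasFiniteIntegral, Measure.volume_eq_prod (V × V) ℝ,
    lintegral_prod_symm _ (hg.measurable_pairingFourier hw).enorm.aemeasurable]
  have e : ∀ l, ∫⁻ z : V × V, ‖pairingFourier g w z.1 z.2 l‖ₑ =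
      (∫⁻ x, ‖verticalFourier w x l‖ₑ) * ∫⁻ y, ‖verticalFourier g y l‖ₑ := fun l => by
    simp only [enorm_pairingFourier]
    exact lintegral_prod_mul (hmw.comp measurable_prodMk_right).enorm.aemeasurable
      (hmg.comp measurable_prodMk_right).enorm.aemeasurable
  simp only [e]
  refine (ENNReal.lintegral_mul_le_Lp_mul_Lq volume Real.HolderConjugate.two_two
    ha.aemeasurable hb.aemeasurable).trans_lt ?_
  refine ENNReal.mul_lt_top ?_ ?_
  · exact ENNReal.rpow_lt_top_of_nonneg (by norm_num)
      hw.lintegral_lintegral_verticalFourier_sq_lt_top.ne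
  · exact ENNReal.rpow_lt_top_of_nonneg (by norm_num)
      hg.lintegral_lintegral_verticalFourier_sq_lt_top.ne

theorem fourier_slice_add (g : V × ℝ → ℝ) (y : V) (c l : ℝ) :
    𝓕 (fun t => (g (y, t + c) : ℂ)) l = Real.fourierChar (c * l) • verticalFourier g y l := by
  have h := VectorFourier.fourierIntegral_comp_add_right Real.fourierChar (volume : Measure ℝ)
    (innerₗ ℝ) (fun t => (g (y, t) : ℂ)) c
  have h2 := congrFun h l
  rw [innerₗ_apply_apply] at h2
  simp only [RCLike.inner_apply, conj_trivial] at h2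
  rw [mul_comm c l]
  exact h2

theorem integral_pairing_eq (hg : BoundedSupported g) (hw : BoundedSupported w) (x y : V) :
    ((∫ t, w (x, t) * g (y, t + inner ℝ x y) : ℝ) : ℂ) = ∫ l, pairingFourier g w x y l := by
  have h := integral_conj_fourier_mul_fourier (hw.integrable_slice_zero x)
    (hw.memLp_slice_zero x 2) (hg.integrable_slice y (inner ℝ x y))
    (hg.memLp_slice y (inner ℝ x y) 2)
  rw [← integral_complex_ofReal]
  calc _ = ∫ t, conj (w (x, t) : ℂ) * (g (y, t + inner ℝ x y) : ℂ) := by simp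
    _ = _ := by
      rw [← h]
      refine integral_congr_ae (Filter.Eventually.of_forall fun l => ?_)
      simp only [pairingFourier, fourier_slice_add]
      rfl

/-- The character produced by the translation `t + ⟨x, y⟩` is the Fourier kernel in `y` at frequency
`-l x`. -/
theorem integral_pairingFourier_eq (g w : V × ℝ → ℝ) (x : V) (l : ℝ) :
    ∫ y, pairingFourier g w x y l =
      conj (verticalFourier w x l) * 𝓕 (fun y => verticalFourier g y l) ((-l) • x) := by
  simp only [pairingFourier]
  rw [integral_const_mul, Real.fourier_eq]
  congr 1
  refine integral_congr_ae (Filter.Eventually.of_forall fun y => ?_)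
  beta_reduce
  rw [real_inner_smul_right, real_inner_comm, neg_mul, neg_neg, mul_comm]

/-- Parseval in `t` at fixed `(x, y)`, then Fubini so that `y` is integrated first at fixed `l` and
`x`. Taking absolute values only after the `y` integration keeps the oscillation. -/
theorem lintegral_pairing_le (hg : BoundedSupported g) (hw : BoundedSupported w)
    (hg0 : ∀ z, 0 ≤ g z) (hw0 : ∀ z, 0 ≤ w z) :
    ∫⁻ z : (V × V) × ℝ, ENNReal.ofReal (w (z.1.1, z.2)) *
        ENNReal.ofReal (g (z.1.2, z.2 + inner ℝ z.1.1 z.1.2)) ≤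
      ∫⁻ l, ∫⁻ x, ‖verticalFourier w x l‖ₑ *
        ‖𝓕 (fun y => verticalFourier g y l) ((-l) • x)‖ₑ := by
  have hH := hg.integrable_pairingFourier hw
  have hI : ∀ x y, Integrable fun t => w (x, t) * g (y, t + inner ℝ x y) := fun x y => by
    have := (hw.memLp_slice_zero x 2).integrable_mul (hg.memLp_slice y (inner ℝ x y) 2)
    have h2 := this.re
    refine h2.congr (Filter.Eventually.of_forall fun t => ?_)
    simp
  have hmeas : Measurable fun z : (V × V) × ℝ => ENNReal.ofReal (w (z.1.1, z.2)) *
        ENNReal.ofReal (g (z.1.2, z.2 + inner ℝ z.1.1 z.1.2)) := by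
    have h1 : Measurable fun z : (V × V) × ℝ => w (z.1.1, z.2) :=
      hw.measurable.comp (by fun_prop)
    have h2 : Measurable fun z : (V × V) × ℝ => g (z.1.2, z.2 + inner ℝ z.1.1 z.1.2) :=
      hg.measurable.comp (by fun_prop)
    exact h1.ennreal_ofReal.mul h2.ennreal_ofReal
  set I : V × V → ℝ := fun z => ∫ t, w (z.1, t) * g (z.2, t + inner ℝ z.1 z.2) with hIdef
  have hIC : ∀ z, (I z : ℂ) = ∫ l, pairingFourier g w z.1 z.2 l := fun z =>
    hg.integral_pairing_eq hw z.1 z.2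
  have hI0 : ∀ z, 0 ≤ I z := fun z => integral_nonneg fun t => mul_nonneg (hw0 _) (hg0 _)
  have hIint : Integrable fun z => (I z : ℂ) := by
    simp only [hIC]
    exact hH.integral_prod_left
  calc _ = ∫⁻ z : V × V, ENNReal.ofReal (I z) := by
        rw [Measure.volume_eq_prod (V × V) ℝ, lintegral_prod _ hmeas.aemeasurable]
        refine lintegral_congr fun z => ?_
        rw [hIdef, ofReal_integral_eq_lintegral_ofReal (hI z.1 z.2)
          (Filter.Eventually.of_forall fun t => mul_nonneg (hw0 _) (hg0 _))]
        refine lintegral_congr fun t => ?_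
        rw [ENNReal.ofReal_mul (hw0 _)]
    -- Nonnegativity of `g` and `w` makes the integral equal to its modulus, so nothing is lost in
    -- passing to complex integrals.
    _ = ‖∫ z, (I z : ℂ)‖ₑ := by
        rw [← ofReal_integral_eq_lintegral_ofReal ?_ (Filter.Eventually.of_forall hI0),
          integral_complex_ofReal, ← ofReal_norm, Complex.norm_real, Real.norm_of_nonneg
          (integral_nonneg hI0)]
        have := hIint.re
        simpa using this
    _ = ‖∫ l, ∫ z : V × V, pairingFourier g w z.1 z.2 l‖ₑ := by
        simp only [hIC]
        rw [integral_integral_swap hH]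
    _ ≤ ∫⁻ l, ‖∫ z : V × V, pairingFourier g w z.1 z.2 l‖ₑ := enorm_integral_le_lintegral_enorm _
    _ ≤ _ := by
        refine lintegral_mono_ae ?_
        filter_upwards [hH.prod_left_ae] with l hl
        rw [Measure.volume_eq_prod V V, integral_prod _ hl]
        refine (enorm_integral_le_lintegral_enorm _).trans (lintegral_mono fun x => ?_)
        rw [integral_pairingFourier_eq, enorm_mul, ← ofReal_norm (conj _), RCLike.norm_conj,
          ofReal_norm]

end BoundedSupported

end Heis

/-! ### The `L^p` bound for the pairing and for the Radon-type transform. -/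

namespace Heis
open scoped FourierTransform ComplexConjugate

variable {V : Type*} [NormedAddCommGroup V] [InnerProductSpace ℝ V] [FiniteDimensional ℝ V]
  [MeasurableSpace V] [BorelSpace V]

theorem lintegral_comp_smul (F : V → ℝ≥0∞) (hF : Measurable F) {r : ℝ} (hr : r ≠ 0) :
    ∫⁻ x, F (r • x) = ENNReal.ofReal |(r ^ Module.finrank ℝ V)⁻¹| * ∫⁻ x, F x := by
  rw [← lintegral_map hF (measurable_const_smul r), Measure.map_addHaar_smul volume hr,
    lintegral_smul_measure, smul_eq_mul]

theorem hausdorff_young_smul {p q : ℝ} (hpq : p.HolderConjugate q) (hq : 2 < q) :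
    ∃ C : ℝ≥0, ∀ f : V → ℂ, Measurable f → Integrable f → MemLp f 2 → ∀ l : ℝ, l ≠ 0 →
      (∫⁻ x, ‖𝓕 f (l • x)‖ₑ ^ q) ^ (1 / q) ≤
        C * ENNReal.ofReal (|l| ^ (-(Module.finrank ℝ V / q : ℝ))) *
          (∫⁻ v, ‖f v‖ₑ ^ p) ^ (1 / p) := by
  obtain ⟨C, hC⟩ := hausdorff_young (V := V) hpq hq
  have hq0 : 0 < q := by linarith
  refine ⟨C ^ (1 / q), fun f hm hf hf2 l hl => ?_⟩
  have hl' : 0 < |l| := abs_pos.2 hl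
  rw [lintegral_comp_smul (fun x => ‖𝓕 f x‖ₑ ^ q)
    ((continuous_fourier hf).measurable.enorm.pow_const q) hl]
  calc _ ≤ (ENNReal.ofReal |(l ^ Module.finrank ℝ V)⁻¹| *
        (C * (∫⁻ v, ‖f v‖ₑ ^ p) ^ (q - 1))) ^ (1 / q) := by
        gcongr
        exact hC f hm hf hf2
    _ = _ := by
        have h1 : 0 ≤ 1 / q := by positivity
        have e1 : ENNReal.ofReal |(l ^ Module.finrank ℝ V)⁻¹| ^ (1 / q) =
            ENNReal.ofReal (|l| ^ (-(Module.finrank ℝ V / q : ℝ))) := by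
          rw [ENNReal.ofReal_rpow_of_nonneg (abs_nonneg _) h1, abs_inv, abs_pow,
            ← Real.rpow_natCast, ← Real.rpow_neg hl'.le, ← Real.rpow_mul hl'.le]
          congr 2; ring
        have e2 : (q - 1) * (1 / q) = 1 / p := by
          have := hpq.inv_add_inv_eq_one
          rw [one_div, one_div, sub_mul, mul_inv_cancel₀ hq0.ne']; linarith
        rw [ENNReal.mul_rpow_of_nonneg _ _ h1, ENNReal.mul_rpow_of_nonneg _ _ h1, e1,
          ← ENNReal.rpow_mul, e2, ENNReal.coe_rpow_of_nonneg _ h1]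
        ring

/-- Minkowski with exponent `2 / p > 1`, for `‖ĝ‖ ^ p` and the measure `|l| ^ (-σ) dl`, puts the `l`
norm inside the `y` integral; Pitt's inequality then applies to each slice `g(y, ·)`. -/
theorem lintegral_verticalFourier_pitt {p σ : ℝ} (hp : 1 < p) (hσ : σ = 2 / p - 1) (hσ0 : 0 < σ) :
    ∃ C : ℝ≥0, ∀ g : V × ℝ → ℝ, BoundedSupported g →
      ∫⁻ l, ENNReal.ofReal (|l| ^ (-σ)) * (∫⁻ y, ‖verticalFourier g y l‖ₑ ^ p) ^ (2 / p) ≤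
        C * (∫⁻ z, ‖g z‖ₑ ^ p) ^ (2 / p) := by
  obtain ⟨C, hC⟩ := pitt_inequality hp hσ hσ0
  have hp0 : 0 < p := by linarith
  refine ⟨C, fun g hg => ?_⟩
  have hr : 1 < 2 / p := by linarith
  have hrs := Real.HolderConjugate.conjExponent hr
  have hmv := hg.measurable_verticalFourier
  have hω : Measurable fun l : ℝ => ENNReal.ofReal (|l| ^ (-σ)) := by fun_prop
  set ν : Measure ℝ := volume.withDensity fun l => ENNReal.ofReal (|l| ^ (-σ)) with hν
  have : SigmaFinite ν := SigmaFinite.withDensity_ofReal _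
  have hu : Measurable (Function.uncurry fun y l => ‖verticalFourier g y l‖ₑ ^ p) :=
    hmv.enorm.pow_const p
  have hM := lintegral_rpow_lintegral_le (μ := (volume : Measure V)) (ν := ν) hrs hu
  have hmul : ∀ F : ℝ → ℝ≥0∞, Measurable F →
      ∫⁻ l, F l ∂ν = ∫⁻ l, ENNReal.ofReal (|l| ^ (-σ)) * F l := fun F hF =>
    lintegral_withDensity_eq_lintegral_mul _ hω hF
  have hmg : Measurable fun z => ‖g z‖ₑ ^ p := hg.measurable.enorm.pow_const p
  have e1 : (1 : ℝ) / (2 / p) = p / 2 := by rw [one_div_div]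
  have hp2 : 0 ≤ p / 2 := by positivity
  have e2 : 2 / p * (p / 2) = 1 := by field_simp
  have hpt : ∀ y, (∫⁻ l, (‖verticalFourier g y l‖ₑ ^ p) ^ (2 / p) ∂ν) ^ (1 / (2 / p)) ≤
      C ^ (p / 2) * ∫⁻ t, ‖g (y, t)‖ₑ ^ p := by
    intro y
    have e3 : ∀ l, (‖verticalFourier g y l‖ₑ ^ p) ^ (2 / p) =
        ‖verticalFourier g y l‖ₑ ^ (2 : ℝ) := fun l => by
      rw [← ENNReal.rpow_mul]; congr 1; field_simp
    simp only [e3]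
    rw [e1, hmul (fun l => ‖verticalFourier g y l‖ₑ ^ (2 : ℝ))
      ((hmv.comp measurable_prodMk_left).enorm.pow_const _)]
    refine (ENNReal.rpow_le_rpow (hC (fun t => (g (y, t) : ℂ)) (hg.measurable_slice_zero y)
      (hg.integrable_slice_zero y) (hg.memLp_slice_zero y 2)) hp2).trans_eq ?_
    rw [ENNReal.mul_rpow_of_nonneg _ _ hp2, ← ENNReal.rpow_mul, e2, ENNReal.rpow_one]
    congr 1
    refine lintegral_congr fun t => ?_
    rw [← ofReal_norm, Complex.norm_real, ofReal_norm]
  have hM2 := hM.trans (lintegral_mono hpt)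
  rw [lintegral_const_mul _ hmg.lintegral_prod_right', e1,
    ← lintegral_prod _ hmg.aemeasurable, ← Measure.volume_eq_prod] at hM2
  have hM3 := ENNReal.rpow_le_rpow hM2 (by positivity : 0 ≤ 2 / p)
  have e4 : p / 2 * (2 / p) = 1 := by field_simp
  rw [ENNReal.mul_rpow_of_nonneg _ _ (by positivity), ← ENNReal.rpow_mul, ← ENNReal.rpow_mul, e4,
    ENNReal.rpow_one, ENNReal.rpow_one,
    hmul (fun l => (∫⁻ y, ‖verticalFourier g y l‖ₑ ^ p) ^ (2 / p))
      (hu.lintegral_prod_left'.pow_const _)] at hM3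
  exact hM3

theorem BoundedSupported.measurable_verticalFourier_left {g : V × ℝ → ℝ} (hg : BoundedSupported g)
    (l : ℝ) : Measurable fun y => verticalFourier g y l := by
  have h : Measurable fun y : V => (y, l) := by fun_prop
  have h2 := hg.measurable_verticalFourier.comp h
  exact h2

/-- The weighted `L^p` norm `|l|^(-σ/2) ‖ĝ(·, l)‖_p`. -/
def weightedNorm (p σ : ℝ) (g : V × ℝ → ℝ) (l : ℝ) : ℝ≥0∞ :=
  ENNReal.ofReal (|l| ^ (-σ / 2)) * (∫⁻ y, ‖verticalFourier g y l‖ₑ ^ p) ^ (1 / p)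

theorem BoundedSupported.measurable_weightedNorm {g : V × ℝ → ℝ} (hg : BoundedSupported g)
    (p σ : ℝ) : Measurable (weightedNorm p σ g) := by
  have h1 : Measurable fun l => ∫⁻ y, ‖verticalFourier g y l‖ₑ ^ p :=
    Measurable.lintegral_prod_left' (f := fun z : V × ℝ => ‖verticalFourier g z.1 z.2‖ₑ ^ p)
      (hg.measurable_verticalFourier.enorm.pow_const p)
  have h2 : Measurable fun l : ℝ => ENNReal.ofReal (|l| ^ (-σ / 2)) := by fun_prop
  exact h2.mul (h1.pow_const _)

theorem weightedNorm_sq (p σ : ℝ) (g : V × ℝ → ℝ) (l : ℝ) :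
    weightedNorm p σ g l ^ (2 : ℝ) =
      ENNReal.ofReal (|l| ^ (-σ)) * (∫⁻ y, ‖verticalFourier g y l‖ₑ ^ p) ^ (2 / p) := by
  have e1 : -σ / 2 * 2 = -σ := by ring
  have e2 : 1 / p * 2 = 2 / p := by ring
  rw [weightedNorm, ENNReal.mul_rpow_of_nonneg _ _ zero_le_two,
    ENNReal.ofReal_rpow_of_nonneg (by positivity) zero_le_two,
    ← Real.rpow_mul (abs_nonneg _), ← ENNReal.rpow_mul, e1, e2]

theorem lintegral_weightedNorm_sq_le {p σ : ℝ} (hp : 1 < p) (hσ : σ = 2 / p - 1) (hσ0 : 0 < σ) :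
    ∃ C : ℝ≥0, ∀ g : V × ℝ → ℝ, BoundedSupported g → (∀ z, 0 ≤ g z) →
      (∫⁻ l, weightedNorm p σ g l ^ (2 : ℝ)) ^ (1 / 2 : ℝ) ≤
        C * (∫⁻ z, ENNReal.ofReal (g z) ^ p) ^ (1 / p) := by
  obtain ⟨C, hC⟩ := lintegral_verticalFourier_pitt (V := V) hp hσ hσ0
  refine ⟨C ^ (1 / 2 : ℝ), fun g hg hg0 => ?_⟩
  have e2 : ∀ z, ENNReal.ofReal (g z) = ‖g z‖ₑ := fun z => by
    rw [← ofReal_norm, Real.norm_of_nonneg (hg0 z)]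
  have e3 : 2 / p * (1 / 2) = 1 / p := by ring
  simp only [weightedNorm_sq, e2]
  refine (ENNReal.rpow_le_rpow (hC g hg) (by norm_num)).trans_eq ?_
  rw [ENNReal.mul_rpow_of_nonneg _ _ (by norm_num), ← ENNReal.rpow_mul, e3,
    ENNReal.coe_rpow_of_nonneg _ (by norm_num)]

/-- Hölder in `x`, then Hausdorff-Young with dilation by `-l`. The Jacobian gives `|l| ^ (-d/q) =
|l| ^ (-σ)`, of which each function receives half. -/
theorem lintegral_verticalFourier_mul_le {p q σ : ℝ} (hpq : p.HolderConjugate q) (hq : 2 < q)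
    (hd : Module.finrank ℝ V / q = σ) :
    ∃ C : ℝ≥0, ∀ g w : V × ℝ → ℝ, BoundedSupported g → BoundedSupported w → ∀ l : ℝ, l ≠ 0 →
      ∫⁻ x, ‖verticalFourier w x l‖ₑ * ‖𝓕 (fun y => verticalFourier g y l) ((-l) • x)‖ₑ ≤
        C * (weightedNorm p σ g l * weightedNorm p σ w l) := by
  obtain ⟨C, hC⟩ := hausdorff_young_smul (V := V) hpq hq
  refine ⟨C, fun g w hg hw l hl => ?_⟩
  have hgl : Measurable fun y => verticalFourier g y l :=
    hg.measurable_verticalFourier_left l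
  have hwl : Measurable fun x => verticalFourier w x l :=
    hw.measurable_verticalFourier_left l
  have hFg : Measurable fun x => 𝓕 (fun y => verticalFourier g y l) ((-l) • x) :=
    ((continuous_fourier (hg.integrable_verticalFourier l)).comp
      (continuous_const_smul (-l))).measurable
  have h1 : ∫⁻ x, ‖verticalFourier w x l‖ₑ * ‖𝓕 (fun y => verticalFourier g y l) ((-l) • x)‖ₑ ≤
      (∫⁻ x, ‖verticalFourier w x l‖ₑ ^ p) ^ (1 / p) *
        (∫⁻ x, ‖𝓕 (fun y => verticalFourier g y l) ((-l) • x)‖ₑ ^ q) ^ (1 / q) :=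
    ENNReal.lintegral_mul_le_Lp_mul_Lq volume hpq hwl.enorm.aemeasurable hFg.enorm.aemeasurable
  have h2 := hC (fun y => verticalFourier g y l) hgl (hg.integrable_verticalFourier l)
    (hg.memLp_verticalFourier l 2) (-l) (neg_ne_zero.2 hl)
  rw [abs_neg, hd] at h2
  have e : ENNReal.ofReal (|l| ^ (-σ)) =
      ENNReal.ofReal (|l| ^ (-σ / 2)) * ENNReal.ofReal (|l| ^ (-σ / 2)) := by
    rw [← ENNReal.ofReal_mul (by positivity), ← Real.rpow_add (abs_pos.2 hl), add_halves]
  rw [e] at h2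
  refine h1.trans ((mul_le_mul_right h2 _).trans_eq ?_)
  rw [weightedNorm, weightedNorm]
  ring

theorem BoundedSupported.pairing_le {p q σ : ℝ} (hpq : p.HolderConjugate q) (hq : 2 < q)
    (hσ : σ = 2 / p - 1) (hd : Module.finrank ℝ V / q = σ) :
    ∃ C : ℝ≥0, ∀ g w : V × ℝ → ℝ, BoundedSupported g → BoundedSupported w →
      (∀ z, 0 ≤ g z) → (∀ z, 0 ≤ w z) →
      ∫⁻ z : (V × V) × ℝ, ENNReal.ofReal (w (z.1.1, z.2)) *
        ENNReal.ofReal (g (z.1.2, z.2 + inner ℝ z.1.1 z.1.2)) ≤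
      C * (∫⁻ z, ENNReal.ofReal (g z) ^ p) ^ (1 / p) *
        (∫⁻ z, ENNReal.ofReal (w z) ^ p) ^ (1 / p) := by
  have hσ0 : 0 < σ := by
    have := hpq.inv_add_inv_eq_one
    have h2 : q⁻¹ < 2⁻¹ := inv_strictAnti₀ (by norm_num) hq
    rw [hσ, div_eq_mul_inv]; linarith
  obtain ⟨C₁, hC₁⟩ := lintegral_verticalFourier_mul_le (V := V) hpq hq hd
  obtain ⟨C₂, hC₂⟩ := lintegral_weightedNorm_sq_le (V := V) hpq.lt hσ hσ0
  refine ⟨C₁ * (C₂ * C₂), fun g w hg hw hg0 hw0 => ?_⟩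
  have hmg := hg.measurable_weightedNorm p σ
  have hmw := hw.measurable_weightedNorm p σ
  calc _ ≤ ∫⁻ l, ∫⁻ x, ‖verticalFourier w x l‖ₑ *
        ‖𝓕 (fun y => verticalFourier g y l) ((-l) • x)‖ₑ := hg.lintegral_pairing_le hw hg0 hw0
    _ ≤ ∫⁻ l, C₁ * (weightedNorm p σ g l * weightedNorm p σ w l) := by
        refine lintegral_mono_ae ?_
        filter_upwards [compl_mem_ae_iff.2 (measure_singleton (0 : ℝ))] with l hl
        exact hC₁ g w hg hw l hl
    _ = C₁ * ∫⁻ l, weightedNorm p σ g l * weightedNorm p σ w l :=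
        lintegral_const_mul _ (hmg.mul hmw)
    _ ≤ C₁ * ((∫⁻ l, weightedNorm p σ g l ^ (2 : ℝ)) ^ (1 / 2 : ℝ) *
          (∫⁻ l, weightedNorm p σ w l ^ (2 : ℝ)) ^ (1 / 2 : ℝ)) :=
        mul_le_mul_right (ENNReal.lintegral_mul_le_Lp_mul_Lq volume Real.HolderConjugate.two_two
          hmg.aemeasurable hmw.aemeasurable) _
    _ ≤ C₁ * ((C₂ * (∫⁻ z, ENNReal.ofReal (g z) ^ p) ^ (1 / p)) *
          (C₂ * (∫⁻ z, ENNReal.ofReal (w z) ^ p) ^ (1 / p))) :=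
        mul_le_mul_right (mul_le_mul' (hC₂ g hg hg0) (hC₂ w hw hw0)) _
    _ = _ := by
        rw [ENNReal.coe_mul, ENNReal.coe_mul]
        ring

/-- The closed balls of natural radius around the origin of `V × ℝ`. -/
def natBalls (V : Type*) [NormedAddCommGroup V] (m : ℕ) : Set (V × ℝ) := Metric.closedBall 0 m

theorem boundedSupported_truncation {G : V × ℝ → ℝ≥0∞} (hG : Measurable G) (m : ℕ) :
    BoundedSupported fun z =>
      (truncation (natBalls V) G m z).toReal where
  measurable := (measurable_truncation (fun _ => measurableSet_closedBall) hG m).ennreal_toReal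
  exists_bound := ⟨m, fun z => by
    rw [abs_of_nonneg ENNReal.toReal_nonneg]
    exact ENNReal.toReal_le_of_le_ofReal (by positivity)
      (by simpa using truncation_le_natCast _ G m z)⟩
  exists_support := ⟨m, fun y t h => by
    have hz : (y, t) ∈ natBalls V m := by
      by_contra hz
      exact h (by simp [truncation, Set.indicator_of_notMem hz])
    rw [natBalls, mem_closedBall_zero_iff, Prod.norm_mk] at hz
    exact ⟨(le_max_left _ _).trans hz, (le_max_right _ _).trans hz⟩⟩

/-- Monotone convergence removes boundedness and bounded support, since the constant does not depend
on the truncation. -/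
theorem pairing_le {p q σ : ℝ} (hpq : p.HolderConjugate q) (hq : 2 < q)
    (hσ : σ = 2 / p - 1) (hd : Module.finrank ℝ V / q = σ) :
    ∃ C : ℝ≥0, ∀ G W : V × ℝ → ℝ≥0∞, Measurable G → Measurable W →
      ∫⁻ z : (V × V) × ℝ, W (z.1.1, z.2) * G (z.1.2, z.2 + inner ℝ z.1.1 z.1.2) ≤
      C * (∫⁻ z, G z ^ p) ^ (1 / p) * (∫⁻ z, W z ^ p) ^ (1 / p) := by
  obtain ⟨C, hC⟩ := BoundedSupported.pairing_le (V := V) hpq hq hσ hd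
  have hp0 := hpq.nonneg
  refine ⟨C, fun G W hG hW => ?_⟩
  have hSm : Monotone (natBalls V) := fun m n h => Metric.closedBall_subset_closedBall (by exact_mod_cast h)
  have hSU : ∀ z, ∃ m, z ∈ natBalls V m := fun z => by
    obtain ⟨m, hm⟩ := exists_nat_ge ‖z‖
    exact ⟨m, by simpa [natBalls] using hm⟩
  have hTm : ∀ F : V × ℝ → ℝ≥0∞, Measurable F → ∀ m, Measurable (truncation (natBalls V) F m) :=
    fun F hF m => measurable_truncation (fun _ => measurableSet_closedBall) hF m
  have hval : ∀ (F : V × ℝ → ℝ≥0∞) m z, ENNReal.ofReal (truncation (natBalls V) F m z).toReal =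
      truncation (natBalls V) F m z := fun F m z =>
    ENNReal.ofReal_toReal (ne_top_of_le_ne_top (ENNReal.natCast_ne_top m)
      (truncation_le_natCast _ F m z))
  have hle : ∀ m, ∫⁻ z : (V × V) × ℝ, truncation (natBalls V) W m (z.1.1, z.2) *
      truncation (natBalls V) G m (z.1.2, z.2 + inner ℝ z.1.1 z.1.2) ≤
      C * (∫⁻ z, G z ^ p) ^ (1 / p) * (∫⁻ z, W z ^ p) ^ (1 / p) := fun m => by
    have h := hC _ _ (boundedSupported_truncation hG m) (boundedSupported_truncation hW m)
      (fun _ => ENNReal.toReal_nonneg) (fun _ => ENNReal.toReal_nonneg)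
    simp only [hval] at h
    refine h.trans ?_
    gcongr <;> exact truncation_le _ _ _ _
  have hsup : ∀ z : (V × V) × ℝ, W (z.1.1, z.2) * G (z.1.2, z.2 + inner ℝ z.1.1 z.1.2) =
      ⨆ m, truncation (natBalls V) W m (z.1.1, z.2) *
        truncation (natBalls V) G m (z.1.2, z.2 + inner ℝ z.1.1 z.1.2) := fun z => by
    rw [← iSup_truncation hSm hSU W, ← iSup_truncation hSm hSU G]
    refine le_antisymm ?_ (iSup_le fun m => mul_le_mul' (le_iSup
      (fun m => truncation (natBalls V) W m (z.1.1, z.2)) m) (le_iSup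
      (fun m => truncation (natBalls V) G m (z.1.2, z.2 + inner ℝ z.1.1 z.1.2)) m))
    -- The product of the two suprema is a double supremum; by monotonicity it is attained along the
    -- diagonal.
    simp only [ENNReal.iSup_mul, ENNReal.mul_iSup]
    refine iSup_le fun i => iSup_le fun j => le_iSup_of_le (max i j) ?_
    exact mul_le_mul' (monotone_truncation hSm W (by simp) _)
      (monotone_truncation hSm G (by simp) _)
  simp only [hsup]
  rw [lintegral_iSup]
  · exact iSup_le hle
  · intro m
    have h1 : Measurable fun z : (V × V) × ℝ => truncation (natBalls V) W m (z.1.1, z.2) :=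
      (hTm W hW m).comp (by fun_prop)
    have h2 : Measurable fun z : (V × V) × ℝ =>
        truncation (natBalls V) G m (z.1.2, z.2 + inner ℝ z.1.1 z.1.2) :=
      (hTm G hG m).comp (by fun_prop)
    exact h1.mul h2
  · intro m n h z
    exact mul_le_mul' (monotone_truncation hSm W h _) (monotone_truncation hSm G h _)

/-- The Radon-type transform integrating over the hyperplanes `s = t + ⟪x, y⟫`. -/
def radon (G : V × ℝ → ℝ≥0∞) (z : V × ℝ) : ℝ≥0∞ := ∫⁻ y, G (y, z.2 + inner ℝ z.1 y)

theorem measurable_radon {G : V × ℝ → ℝ≥0∞} (hG : Measurable G) : Measurable (radon G) :=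
  Measurable.lintegral_prod_right' (f := fun z : (V × ℝ) × V => G (z.2, z.1.2 + inner ℝ z.1.1 z.2))
    (hG.comp (by fun_prop))

/-- The exponent dual to `q` is `p`, so the test functions of the duality lemma carry the same norm
as `G` and Tonelli reduces the bound to `pairing_le`. -/
theorem radon_bound {p q σ : ℝ} (hpq : p.HolderConjugate q) (hq : 2 < q)
    (hσ : σ = 2 / p - 1) (hd : Module.finrank ℝ V / q = σ) :
    ∃ C : ℝ≥0, ∀ G : V × ℝ → ℝ≥0∞, Measurable G →
      (∫⁻ z, radon G z ^ q) ^ (1 / q) ≤ C * (∫⁻ z, G z ^ p) ^ (1 / p) := by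
  obtain ⟨C, hC⟩ := pairing_le (V := V) hpq hq hσ hd
  refine ⟨C, fun G hG => ?_⟩
  refine lintegral_rpow_le_of_duality hpq.symm (measurable_radon hG) fun W hW => ?_
  refine le_trans (le_of_eq ?_) (hC G W hG hW)
  have hm : Measurable fun z : (V × V) × ℝ =>
      W (z.1.1, z.2) * G (z.1.2, z.2 + inner ℝ z.1.1 z.1.2) :=
    (hW.comp (g := W) (f := fun z : (V × V) × ℝ => (z.1.1, z.2)) (by fun_prop)).mul
      (hG.comp (g := G) (f := fun z : (V × V) × ℝ => (z.1.2, z.2 + inner ℝ z.1.1 z.1.2))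
        (by fun_prop))
  rw [Measure.volume_eq_prod (V × V) ℝ, lintegral_prod _ hm.aemeasurable,
    Measure.volume_eq_prod V V, lintegral_prod _ hm.lintegral_prod_right'.aemeasurable,
    Measure.volume_eq_prod V ℝ, lintegral_prod (fun z => radon G z * W z) ((measurable_radon hG).mul hW).aemeasurable]
  refine lintegral_congr fun x => ?_
  have hm2 : Measurable fun z : V × ℝ => W (x, z.2) * G (z.1, z.2 + inner ℝ x z.1) :=
    hm.comp (g := fun z : (V × V) × ℝ => W (z.1.1, z.2) * G (z.1.2, z.2 + inner ℝ z.1.1 z.1.2))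
      (f := fun z : V × ℝ => ((x, z.1), z.2)) (by fun_prop)
  rw [lintegral_lintegral_swap hm2.aemeasurable]
  refine lintegral_congr fun t => ?_
  have hm3 : Measurable fun y : V => G (y, t + inner ℝ x y) := hG.comp (by fun_prop)
  exact (mul_comm _ _).trans (lintegral_const_mul (W (x, t)) hm3).symm

end Heis

/-! ### The Radon-type transform in coordinates. -/

namespace Heis

section RadonPi

variable {ι : Type*} [Fintype ι]

/-- The Radon-type transform in coordinates. -/
def radonPi (G : (ι → ℝ) × ℝ → ℝ≥0∞) (z : (ι → ℝ) × ℝ) : ℝ≥0∞ := ∫⁻ y, G (y, z.2 + z.1 ⬝ᵥ y)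

theorem measurable_radonPi {G : (ι → ℝ) × ℝ → ℝ≥0∞} (hG : Measurable G) :
    Measurable (radonPi G) := by
  have h : Measurable fun z : ((ι → ℝ) × ℝ) × (ι → ℝ) => (z.2, z.1.2 + z.1.1 ⬝ᵥ z.2) := by
    have : Continuous fun z : ((ι → ℝ) × ℝ) × (ι → ℝ) => (z.2, z.1.2 + z.1.1 ⬝ᵥ z.2) := by
      fun_prop
    exact this.measurable
  have h2 := hG.comp h
  exact Measurable.lintegral_prod_right' h2

theorem radonPi_bound {p q σ : ℝ} (hpq : p.HolderConjugate q) (hq : 2 < q)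
    (hσ : σ = 2 / p - 1) (hd : Fintype.card ι / q = σ) :
    ∃ C : ℝ≥0, ∀ G : (ι → ℝ) × ℝ → ℝ≥0∞, Measurable G →
      (∫⁻ z, radonPi G z ^ q) ^ (1 / q) ≤ C * (∫⁻ z, G z ^ p) ^ (1 / p) := by
  obtain ⟨C, hC⟩ := radon_bound (V := EuclideanSpace ℝ ι) hpq hq hσ
    (by rw [finrank_euclideanSpace]; exact hd)
  refine ⟨C, fun G hG => ?_⟩
  have hofLp : MeasurePreserving (WithLp.ofLp : EuclideanSpace ℝ ι → ι → ℝ) :=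
    PiLp.volume_preserving_ofLp ι
  have he : MeasurePreserving (Prod.map (WithLp.ofLp : EuclideanSpace ℝ ι → ι → ℝ) (id : ℝ → ℝ))
      (volume.prod volume) (volume.prod volume) := hofLp.prod (MeasurePreserving.id volume)
  have h1 := hC (fun z => G (z.1.ofLp, z.2)) (hG.comp he.measurable)
  have h2 : ∀ z : EuclideanSpace ℝ ι × ℝ, radon (fun z => G (z.1.ofLp, z.2)) z =
      radonPi G (z.1.ofLp, z.2) := fun z => by
    have hm : Measurable fun y : ι → ℝ => G (y, z.2 + z.1.ofLp ⬝ᵥ y) := by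
      have : Continuous fun y : ι → ℝ => (y, z.2 + z.1.ofLp ⬝ᵥ y) := by fun_prop
      exact hG.comp this.measurable
    rw [radon, radonPi, ← hofLp.lintegral_comp hm]
    refine lintegral_congr fun y => ?_
    simp only [EuclideanSpace.inner_eq_star_dotProduct, star_trivial]
    rw [dotProduct_comm]
  simp only [h2] at h1
  have h3 := he.lintegral_comp ((measurable_radonPi hG).pow_const q)
  have h4 := he.lintegral_comp (hG.pow_const p)
  simp only [Prod.map, id] at h3 h4
  rw [Measure.volume_eq_prod] at h1
  rw [h3, h4] at h1
  exact h1

end RadonPi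

/-! ### Reduction of the Heisenberg convolution to the Radon-type transform. -/

variable {n : ℕ}

theorem continuous_quadForm (A : Matrix (Fin n ⊕ Fin n) (Fin n ⊕ Fin n) ℝ) :
    Continuous (quadForm A) := by
  have h : Continuous (fun y : Fin n ⊕ Fin n → ℝ => y ⬝ᵥ (A *ᵥ y)) := by
    fun_prop
  exact h

theorem continuous_symp : Continuous fun z : (Fin n ⊕ Fin n → ℝ) × (Fin n ⊕ Fin n → ℝ) =>
    symp z.1 z.2 := by
  have h : Continuous fun z : (Fin n ⊕ Fin n → ℝ) × (Fin n ⊕ Fin n → ℝ) =>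
      z.1 ⬝ᵥ (symplecticJ n *ᵥ z.2) := by
    fun_prop
  exact h

/-- Symmetry of `A` merges the cross terms of the quadratic form into `2 xᵗAy`, and `xᵗJx = 0`
leaves `xᵗJy`; together they are `xᵗ(2A + J)y`. -/
theorem phase_identity {A : Matrix (Fin n ⊕ Fin n) (Fin n ⊕ Fin n) ℝ} (hA : A.IsSymm)
    (x y : Fin n ⊕ Fin n → ℝ) :
    -quadForm A (x - y) - symp x (x - y) =
      -quadForm A x + (((2 : ℝ) • A + symplecticJ n)ᵀ *ᵥ x) ⬝ᵥ y - quadForm A y := by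
  have h1 := symp_self x
  have h2 : y ⬝ᵥ (A *ᵥ x) = x ⬝ᵥ (A *ᵥ y) := by
    rw [Matrix.dotProduct_mulVec, ← Matrix.mulVec_transpose, hA.eq, dotProduct_comm]
  have h3 : (((2 : ℝ) • A + symplecticJ n)ᵀ *ᵥ x) ⬝ᵥ y =
      2 * x ⬝ᵥ (A *ᵥ y) + symp x y := by
    rw [Matrix.mulVec_transpose, ← Matrix.dotProduct_mulVec, Matrix.add_mulVec,
      Matrix.smul_mulVec, dotProduct_add, dotProduct_smul, smul_eq_mul, symp]
  have h4 : symp x (x - y) = symp x x - symp x y := by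
    simp only [symp, Matrix.mulVec_sub, dotProduct_sub]
  rw [h3, h4, h1]
  simp only [quadForm, Matrix.mulVec_sub, dotProduct_sub, sub_dotProduct, h2]
  ring

theorem lintegral_graph_eq_radonPi {A : Matrix (Fin n ⊕ Fin n) (Fin n ⊕ Fin n) ℝ}
    (hA : A.IsSymm) (F : (Fin n ⊕ Fin n → ℝ) × ℝ → ℝ≥0∞) (x : Fin n ⊕ Fin n → ℝ) (t : ℝ) :
    ∫⁻ y, F (x + -y, t + -quadForm A y + symp x (-y)) =
      radonPi (fun z => F (z.1, z.2 - quadForm A z.1))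
        (((2 : ℝ) • A + symplecticJ n)ᵀ *ᵥ x, t - quadForm A x) := by
  rw [← lintegral_sub_left_eq_self _ x, radonPi]
  refine lintegral_congr fun y => ?_
  have h := phase_identity hA x y
  have h2 : symp x (-(x - y)) = -symp x (x - y) := by
    simp only [symp, Matrix.mulVec_neg, dotProduct_neg]
  have h3 : x + -(x - y) = y := by abel
  rw [h2, h3]
  congr 2
  simp only
  linarith

theorem lintegral_shear {φ : (Fin n ⊕ Fin n → ℝ) → ℝ} (hφ : Continuous φ)
    {F : (Fin n ⊕ Fin n → ℝ) × ℝ → ℝ≥0∞} (hF : Measurable F) :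
    ∫⁻ z : (Fin n ⊕ Fin n → ℝ) × ℝ, F (z.1, z.2 - φ z.1) = ∫⁻ z, F z := by
  have h : Measurable fun z : (Fin n ⊕ Fin n → ℝ) × ℝ => F (z.1, z.2 - φ z.1) := by
    have : Continuous fun z : (Fin n ⊕ Fin n → ℝ) × ℝ => (z.1, z.2 - φ z.1) := by fun_prop
    exact hF.comp this.measurable
  rw [Measure.volume_eq_prod, lintegral_prod _ h.aemeasurable, lintegral_prod _ hF.aemeasurable]
  refine lintegral_congr fun y => ?_
  exact lintegral_sub_right_eq_self (fun t => F (y, t)) (φ y)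

theorem lintegral_mulVec_left {B : Matrix (Fin n ⊕ Fin n) (Fin n ⊕ Fin n) ℝ} (hB : B.det ≠ 0)
    {F : (Fin n ⊕ Fin n → ℝ) × ℝ → ℝ≥0∞} (hF : Measurable F) :
    ∫⁻ z : (Fin n ⊕ Fin n → ℝ) × ℝ, F (B *ᵥ z.1, z.2) =
      ENNReal.ofReal |B.det⁻¹| * ∫⁻ z, F z := by
  have hc : Continuous fun x : Fin n ⊕ Fin n → ℝ => B *ᵥ x := by fun_prop
  have h : Measurable fun z : (Fin n ⊕ Fin n → ℝ) × ℝ => F (B *ᵥ z.1, z.2) := by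
    have : Continuous fun z : (Fin n ⊕ Fin n → ℝ) × ℝ => (B *ᵥ z.1, z.2) := by fun_prop
    exact hF.comp this.measurable
  have hmap := Real.map_matrix_volume_pi_eq_smul_volume_pi hB
  have hfun : (⇑(Matrix.toLin' B) : (Fin n ⊕ Fin n → ℝ) → Fin n ⊕ Fin n → ℝ) = fun x => B *ᵥ x := by
    ext x; simp
  rw [hfun] at hmap
  rw [Measure.volume_eq_prod, lintegral_prod _ h.aemeasurable, lintegral_prod _ hF.aemeasurable,
    ← smul_eq_mul, ← lintegral_smul_measure, ← hmap,
    lintegral_map hF.lintegral_prod_right' hc.measurable]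

/-- The shears by `φ` on the input and on the output preserve both norms; the map `x ↦ Bx` costs the
factor `|det B| ^ (-1/q)`. -/
theorem conv_bound_prod {A : Matrix (Fin n ⊕ Fin n) (Fin n ⊕ Fin n) ℝ} (hA : A.IsSymm)
    (hdet : ((2 : ℝ) • A + symplecticJ n).det ≠ 0) {p q σ : ℝ} (hpq : p.HolderConjugate q)
    (hq : 2 < q) (hσ : σ = 2 / p - 1) (hd : (2 * n : ℝ) / q = σ) :
    ∃ C : ℝ≥0, ∀ F : (Fin n ⊕ Fin n → ℝ) × ℝ → ℝ≥0∞, Measurable F →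
      (∫⁻ z : (Fin n ⊕ Fin n → ℝ) × ℝ,
        (∫⁻ y, F (z.1 + -y, z.2 + -quadForm A y + symp z.1 (-y))) ^ q) ^ (1 / q) ≤
        C * (∫⁻ z, F z ^ p) ^ (1 / p) := by
  obtain ⟨C, hC⟩ := radonPi_bound (ι := Fin n ⊕ Fin n) hpq hq hσ
    (by rw [← hd]; simp; ring)
  set B := ((2 : ℝ) • A + symplecticJ n)ᵀ with hB
  have hBdet : B.det ≠ 0 := by rwa [hB, Matrix.det_transpose]
  have hq1 : 0 ≤ 1 / q := by positivity
  refine ⟨(Real.toNNReal |B.det⁻¹|) ^ (1 / q) * C, fun F hF => ?_⟩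
  have hφ := continuous_quadForm A
  set G : (Fin n ⊕ Fin n → ℝ) × ℝ → ℝ≥0∞ := fun z => F (z.1, z.2 - quadForm A z.1) with hG
  have hGm : Measurable G := by
    have : Continuous fun z : (Fin n ⊕ Fin n → ℝ) × ℝ => (z.1, z.2 - quadForm A z.1) := by fun_prop
    exact hF.comp this.measurable
  have hRm := (measurable_radonPi hGm).pow_const q
  have e1 : ∫⁻ z : (Fin n ⊕ Fin n → ℝ) × ℝ,
      (∫⁻ y, F (z.1 + -y, z.2 + -quadForm A y + symp z.1 (-y))) ^ q =
      ENNReal.ofReal |B.det⁻¹| * ∫⁻ z, radonPi G z ^ q := by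
    simp only [lintegral_graph_eq_radonPi hA F]
    have hm2 : Measurable fun z : (Fin n ⊕ Fin n → ℝ) × ℝ => radonPi G (B *ᵥ z.1, z.2) ^ q := by
      have : Continuous fun z : (Fin n ⊕ Fin n → ℝ) × ℝ => (B *ᵥ z.1, z.2) := by fun_prop
      exact hRm.comp this.measurable
    rw [← lintegral_mulVec_left hBdet hRm, ← lintegral_shear hφ hm2]
  have e2 : ∫⁻ z, G z ^ p = ∫⁻ z, F z ^ p := lintegral_shear hφ (hF.pow_const p)
  rw [e1, ENNReal.mul_rpow_of_nonneg _ _ hq1, ENNReal.coe_mul, ENNReal.coe_rpow_of_nonneg _ hq1,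
    mul_assoc, ← e2]
  exact mul_le_mul_right (hC G hGm) _

/-! ### From nonnegative measurable functions to complex `L^p` functions. -/

namespace HeisenbergGroup

instance : SigmaFinite (volume : Measure (HeisenbergGroup n)) :=
  inferInstanceAs (SigmaFinite (volume : Measure ((Fin n ⊕ Fin n → ℝ) × ℝ)))

instance : SecondCountableTopology (HeisenbergGroup n) :=
  inferInstanceAs (SecondCountableTopology ((Fin n ⊕ Fin n → ℝ) × ℝ))

theorem measurable_mul_inv :
    Measurable fun z : HeisenbergGroup n × HeisenbergGroup n => z.1 * z.2⁻¹ := by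
  have h : Continuous fun z : ((Fin n ⊕ Fin n → ℝ) × ℝ) × ((Fin n ⊕ Fin n → ℝ) × ℝ) =>
      (z.1.1 + -z.2.1, z.1.2 + -z.2.2 + symp z.1.1 (-z.2.1)) := by
    have hs : Continuous fun z : ((Fin n ⊕ Fin n → ℝ) × ℝ) × ((Fin n ⊕ Fin n → ℝ) × ℝ) =>
        symp z.1.1 (-z.2.1) :=
      continuous_symp.comp (f := fun z : ((Fin n ⊕ Fin n → ℝ) × ℝ) × ((Fin n ⊕ Fin n → ℝ) × ℝ) =>
        (z.1.1, -z.2.1)) (by fun_prop)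
    fun_prop
  exact h.measurable

end HeisenbergGroup

instance (A : Matrix (Fin n ⊕ Fin n) (Fin n ⊕ Fin n) ℝ) : SFinite (graphMeasure A) := by
  unfold graphMeasure
  infer_instance

theorem lintegral_graphMeasure (A : Matrix (Fin n ⊕ Fin n) (Fin n ⊕ Fin n) ℝ)
    {F : HeisenbergGroup n → ℝ≥0∞} (hF : Measurable F) (z : HeisenbergGroup n) :
    ∫⁻ q, F (z * q⁻¹) ∂graphMeasure A =
      ∫⁻ y : Fin n ⊕ Fin n → ℝ, F (z.1 + -y, z.2 + -quadForm A y + symp z.1 (-y)) := by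
  have h : Measurable fun q : HeisenbergGroup n => F (z * q⁻¹) :=
    hF.comp (HeisenbergGroup.measurable_mul_inv.comp measurable_prodMk_left)
  rw [graphMeasure, lintegral_map h (measurable_graphMap A)]
  rfl

/-- The `L^p → L^q` bound for convolution of nonnegative functions with `graphMeasure A`. -/
theorem conv_bound {A : Matrix (Fin n ⊕ Fin n) (Fin n ⊕ Fin n) ℝ} (hA : A.IsSymm)
    (hdet : ((2 : ℝ) • A + symplecticJ n).det ≠ 0) {p q σ : ℝ} (hpq : p.HolderConjugate q)
    (hq : 2 < q) (hσ : σ = 2 / p - 1) (hd : (2 * n : ℝ) / q = σ) :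
    ∃ C : ℝ≥0, ∀ F : HeisenbergGroup n → ℝ≥0∞, Measurable F →
      (∫⁻ z : HeisenbergGroup n, (∫⁻ y, F (z * y⁻¹) ∂graphMeasure A) ^ q) ^ (1 / q) ≤
        C * (∫⁻ z, F z ^ p) ^ (1 / p) := by
  obtain ⟨C, hC⟩ := conv_bound_prod hA hdet hpq hq hσ hd
  refine ⟨C, fun F hF => ?_⟩
  simp only [lintegral_graphMeasure A hF]
  exact hC F hF

theorem measurable_lintegral_mul_inv {F : HeisenbergGroup n → ℝ≥0∞} (hF : Measurable F)
    (μ : Measure (HeisenbergGroup n)) [SFinite μ] : Measurable fun z => ∫⁻ y, F (z * y⁻¹) ∂μ := by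
  have h := hF.comp HeisenbergGroup.measurable_mul_inv
  exact Measurable.lintegral_prod_right' h

theorem stronglyMeasurable_rightConv {f : HeisenbergGroup n → ℂ} (hf : StronglyMeasurable f)
    (μ : Measure (HeisenbergGroup n)) [SFinite μ] : StronglyMeasurable (rightConv f μ) := by
  have h := hf.comp_measurable HeisenbergGroup.measurable_mul_inv
  exact StronglyMeasurable.integral_prod_right' h

/-- The bound for nonnegative functions, applied to `‖f‖`, gives absolute convergence and the norm
estimate. Since `μ` may be singular, independence of the representative of `f` is not automatic; it
also follows from `hC`. -/
theorem rightConv_bounds {μ : Measure (HeisenbergGroup n)} [SFinite μ] {p q : ℝ} (hp : 0 < p)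
    (hq : 0 < q) {C : ℝ≥0}
    (hC : ∀ F : HeisenbergGroup n → ℝ≥0∞, Measurable F →
      (∫⁻ z, (∫⁻ y, F (z * y⁻¹) ∂μ) ^ q) ^ (1 / q) ≤ C * (∫⁻ z, F z ^ p) ^ (1 / p))
    {f : HeisenbergGroup n → ℂ} (hf : MemLp f (ENNReal.ofReal p)) :
    (∀ᵐ z : HeisenbergGroup n, Integrable (fun y => f (z * y⁻¹)) μ) ∧
      MemLp (rightConv f μ) (ENNReal.ofReal q) ∧
      eLpNorm (rightConv f μ) (ENNReal.ofReal q) ≤ C * eLpNorm f (ENNReal.ofReal p) := by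
  set f' := hf.1.mk f with hf'
  have hf'm : StronglyMeasurable f' := hf.1.stronglyMeasurable_mk
  have hff' : f =ᵐ[volume] f' := hf.1.ae_eq_mk
  have hp1 : 0 < 1 / p := by positivity
  have hq1 : 0 < 1 / q := by positivity
  have eL : ∀ {r : ℝ} (_ : 0 < r) (u : HeisenbergGroup n → ℂ),
      eLpNorm u (ENNReal.ofReal r) = (∫⁻ z, ‖u z‖ₑ ^ r) ^ (1 / r) := fun {r} hr u => by
    rw [eLpNorm_eq_lintegral_rpow_enorm_toReal (by simpa using hr) ENNReal.ofReal_ne_top,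
      ENNReal.toReal_ofReal hr.le]
  obtain ⟨N, hfN, hNm, hN0⟩ := exists_measurable_superset_of_null (ae_iff.1 hff')
  have hae : ∀ᵐ z : HeisenbergGroup n, ∀ᵐ y ∂μ, f (z * y⁻¹) = f' (z * y⁻¹) := by
    have hFm : Measurable (N.indicator fun _ => (1 : ℝ≥0∞)) := measurable_const.indicator hNm
    -- Applied to the indicator of a Lebesgue null set `N`, the bound says that for almost every `z`
    -- the points `z * y⁻¹` avoid `N` for `μ`-almost every `y`.
    have h := hC _ hFm
    have h0 : ∫⁻ z, (N.indicator (fun _ => (1 : ℝ≥0∞)) z) ^ p = 0 := by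
      rw [lintegral_eq_zero_iff (hFm.pow_const p)]
      filter_upwards [compl_mem_ae_iff.2 hN0] with z hz
      simp [Set.indicator_of_notMem hz, hp]
    rw [h0, ENNReal.zero_rpow_of_pos hp1, mul_zero, nonpos_iff_eq_zero,
      ENNReal.rpow_eq_zero_iff_of_pos hq1,
      lintegral_eq_zero_iff ((measurable_lintegral_mul_inv hFm μ).pow_const q)] at h
    filter_upwards [h] with z hz
    simp only [Pi.zero_apply, ENNReal.rpow_eq_zero_iff_of_pos hq] at hz
    have hm : Measurable fun y : HeisenbergGroup n =>
        N.indicator (fun _ => (1 : ℝ≥0∞)) (z * y⁻¹) :=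
      hFm.comp (HeisenbergGroup.measurable_mul_inv.comp measurable_prodMk_left)
    rw [lintegral_eq_zero_iff hm] at hz
    filter_upwards [hz] with y hy
    by_contra hne
    have : z * y⁻¹ ∈ N := hfN hne
    simp [Set.indicator_of_mem this] at hy
  have hfp : ∫⁻ z, ‖f z‖ₑ ^ p = ∫⁻ z, ‖f' z‖ₑ ^ p := by
    refine lintegral_congr_ae ?_
    filter_upwards [hff'] with z hz
    rw [hz]
  have hEm : Measurable fun z => ‖f' z‖ₑ := hf'm.measurable.enorm
  have hb := hC _ hEm
  rw [← hfp, ← eL hp] at hb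
  have hlt : (∫⁻ z, (∫⁻ y, ‖f' (z * y⁻¹)‖ₑ ∂μ) ^ q) ^ (1 / q) < ∞ :=
    hb.trans_lt (ENNReal.mul_lt_top ENNReal.coe_lt_top hf.2)
  have hfin : ∀ᵐ z : HeisenbergGroup n, ∫⁻ y, ‖f' (z * y⁻¹)‖ₑ ∂μ < ∞ := by
    have h1 := (ENNReal.rpow_lt_top_iff_of_pos hq1).1 hlt
    filter_upwards [ae_lt_top ((measurable_lintegral_mul_inv hEm μ).pow_const q) h1.ne] with z hz
    exact (ENNReal.rpow_lt_top_iff_of_pos hq).1 hz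
  have hconv : rightConv f μ =ᵐ[volume] rightConv f' μ := by
    filter_upwards [hae] with z hz
    exact integral_congr_ae hz
  have hbound : eLpNorm (rightConv f μ) (ENNReal.ofReal q) ≤ C * eLpNorm f (ENNReal.ofReal p) := by
    rw [eLpNorm_congr_ae hconv, eL hq]
    refine le_trans ?_ hb
    gcongr with z
    exact enorm_integral_le_lintegral_enorm _
  refine ⟨?_, ⟨?_, hbound.trans_lt (ENNReal.mul_lt_top ENNReal.coe_lt_top hf.2)⟩, hbound⟩
  · filter_upwards [hae, hfin] with z hz hz2
    have hi : Integrable (fun y => f' (z * y⁻¹)) μ :=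
      ⟨(hf'm.comp_measurable (HeisenbergGroup.measurable_mul_inv.comp
        measurable_prodMk_left)).aestronglyMeasurable, hz2⟩
    exact hi.congr (hz.mono fun y hy => hy.symm)
  · exact (stronglyMeasurable_rightConv hf'm μ).aestronglyMeasurable.congr hconv.symm

end Heis

end

theorem theorem3 (n : ℕ) (hn : 1 ≤ n)
    (A : Matrix (Fin n ⊕ Fin n) (Fin n ⊕ Fin n) ℝ) (hA : A.IsSymm)
    (hdet_add : ((2 : ℝ) • A + Heis.symplecticJ n).det ≠ 0)
    (hdet_sub : ((2 : ℝ) • A - Heis.symplecticJ n).det ≠ 0) :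
    ∃ C : ℝ≥0, ∀ f : Heis.HeisenbergGroup n → ℂ,
      MemLp f (ENNReal.ofReal ((2 * n + 2) / (2 * n + 1))) volume →
        (∀ᵐ p : Heis.HeisenbergGroup n ∂volume,
          Integrable (fun q => f (p * q⁻¹)) (Heis.graphMeasure A)) ∧
        MemLp (Heis.rightConv f (Heis.graphMeasure A)) (ENNReal.ofReal (2 * n + 2)) volume ∧
        eLpNorm (Heis.rightConv f (Heis.graphMeasure A)) (ENNReal.ofReal (2 * n + 2)) volume ≤
          C * eLpNorm f (ENNReal.ofReal ((2 * n + 2) / (2 * n + 1))) volume := by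
  have hn' : (1 : ℝ) ≤ n := by exact_mod_cast hn
  have hpq : Real.HolderConjugate ((2 * n + 2) / (2 * n + 1) : ℝ) (2 * n + 2) := by
    rw [Real.holderConjugate_iff]
    constructor
    · rw [lt_div_iff₀ (by positivity)]; linarith
    · field_simp
      ring
  -- This `σ` is the common value of `2 / p - 1` and `2n / q`; the condition `2 < q = 2n + 2` uses
  -- `n ≥ 1`.
  obtain ⟨C, hC⟩ := Heis.conv_bound hA hdet_add (σ := 2 * n / (2 * n + 2)) hpq (by linarith)
    (by field_simp; ring) rfl
  exact ⟨C, fun f hf => Heis.rightConv_bounds hpq.pos hpq.symm.pos hC hf⟩
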